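/- Let $k$ be an algebraically closed field with $\operatorname{char}(k)\neq 2$. Let $D_4$ be the Hopf algebra over $k$ (isomorphic to the Drinfeld double of Sweedler's 4-dimensional Hopf algebra) generated as an algebra by $a,b,c,d$ subject to $$ba=-ab,\quad db=-bd,\quad ca=-ac,\quad dc=-cd,\quad bc=cb,\quad a^2=0,\quad b^2=1,\quad c^2=1,\quad d^2=0,\quad da+ad=1-bc,$$ with comultiplication $\Delta(a)=a\otimes b+1\otimes a$, $\Delta(b)=b\otimes b$, $\Delta(c)=c\otimes c$, $\Delta(d)=d\otimes c+1\otimes d$ and counit $\varepsilon(a)=\varepsilon(d)=0$, $\varepsilon(b)=\varepsilon(c)=1$. Modules are left modules, $\otimes=\otimes_k$ carries the $D_4$-action given by $\Delta$, and $nX$ denotes the direct sum of $n$ copies of $X$. For $r\in\mathbb Z_2=\mathbb Z/2\mathbb Z$ consider the following $D_4$-modules. * $V(r)$ is the one-dimensional module on which $a,d$ act by $0$ and $b,c$ act by $(-1)^r$. * $P(r)$, the projective cover (and injective envelope) of $V(r)$, has a basis $v_1,v_2,v_3,v_4$ with $av_1=v_2$, $av_3=v_4$, $av_2=av_4=0$,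 $dv_1=v_3$, $dv_2=-v_4$, $dv_3=dv_4=0$, where $b$ and $c$ both act on $v_1,v_4$ by $(-1)^r$ and on $v_2,v_3$ by $(-1)^{r+1}$. * For $t\ge 1$ and $\eta\in\mathbb P^1(k)=k\cup\{\infty\}$, $M_t(r,\eta)$ has a basis $v_{1,1},\dots,v_{1,t},v_{2,1},\dots,v_{2,t}$ such that $b$ and $c$ both act on the $v_{1,i}$ by $(-1)^{r+1}$ and on the $v_{2,i}$ by $(-1)^r$, $av_{2,i}=dv_{2,i}=0$, and, with $v_{2,0}:=0$, for $1\le i\le t$: if $\eta\in k$, then $av_{1,i}=v_{2,i}$ and $dv_{1,i}=-v_{2,i-1}-\eta v_{2,i}$; if $\eta=\infty$, then $av_{1,i}=v_{2,i-1}$ and $dv_{1,i}=v_{2,i}$. * For $s\ge 1$, $\Omega^{-s}V(r)$ is the $s$-th cosyzygy of $V(r)$, that is, the module obtained from $V(r)$ by applying $s$ times the operation $L\mapsto I(L)/L$, where $I(L)$ is the injective envelope of $L$ (well defined up to isomorphism). Let $s,t\ge 1$, $r,r'\in\mathbb Z_2$ and $\eta\in\mathbb P^1(k)$. Then there are the following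 isomorphisms of $D_4$-modules. 1. If $s$ is odd, then $M_t(r,\eta)\otimes\Omega^{-s}V(r')\cong st\,P(r+r'+1)\oplus M_t(r+r'+1,\eta)$. 2. If $s$ is even, then $M_t(r,\eta)\otimes\Omega^{-s}V(r')\cong st\,P(r+r')\oplus M_t(r+r',\eta)$. -/

import Mathlib

open scoped TensorProduct

universe u

/-! ### The algebra `D_4` and its coalgebra structure -/

/-- Names of the four algebra generators. -/
inductive D4Gen : Type
  | a | b | c | d

namespace D4

/-- The image of a generator in the free algebra. -/
abbrev gen (k : Type u) [Field k] (x : D4Gen) : FreeAlgebra k D4Gen := FreeAlgebra.ι k x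

/-- The defining relations of `D_4`. -/
inductive Rel (k : Type u) [Field k] : FreeAlgebra k D4Gen → FreeAlgebra k D4Gen → Prop
  | ba : Rel k (gen k .b * gen k .a) (-(gen k .a * gen k .b))
  | db : Rel k (gen k .d * gen k .b) (-(gen k .b * gen k .d))
  | ca : Rel k (gen k .c * gen k .a) (-(gen k .a * gen k .c))
  | dc : Rel k (gen k .d * gen k .c) (-(gen k .c * gen k .d))
  | bc : Rel k (gen k .b * gen k .c) (gen k .c * gen k .b)
  | aa : Rel k (gen k .a ^ 2) 0
  | bb : Rel k (gen k .b ^ 2) 1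
  | cc : Rel k (gen k .c ^ 2) 1
  | dd : Rel k (gen k .d ^ 2) 0
  | da : Rel k (gen k .d * gen k .a + gen k .a * gen k .d) (1 - gen k .b * gen k .c)

end D4

/-- The `k`-algebra `D_4`, generated by `a, b, c, d` subject to the relations `D4.Rel`. -/
def D4 (k : Type u) [Field k] : Type u := RingQuot (D4.Rel k)

namespace D4

section Algebra

variable (k : Type u) [Field k]

instance : Ring (D4 k) := inferInstanceAs (Ring (RingQuot (Rel k)))
instance : Algebra k (D4 k) := inferInstanceAs (Algebra k (RingQuot (Rel k)))

/-- The quotient map from the free algebra. -/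
def mk : FreeAlgebra k D4Gen →ₐ[k] D4 k := RingQuot.mkAlgHom k (Rel k)

/-- The four generators as elements of `D_4`. -/
def of (x : D4Gen) : D4 k := mk k (gen k x)

theorem mk_rel {x y : FreeAlgebra k D4Gen} (h : Rel k x y) : mk k x = mk k y :=
  RingQuot.mkAlgHom_rel k h

/-- The relations of `D_4`, for four elements of an arbitrary ring. -/
structure Relations {B : Type*} [Ring B] (a b c d : B) : Prop where
  ba : b * a = -(a * b)
  db : d * b = -(b * d)
  ca : c * a = -(a * c)
  dc : d * c = -(c * d)
  bc : b * c = c * b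
  aa : a ^ 2 = 0
  bb : b ^ 2 = 1
  cc : c ^ 2 = 1
  dd : d ^ 2 = 0
  da : d * a + a * d = 1 - b * c

theorem relations_of : Relations (of k .a) (of k .b) (of k .c) (of k .d) := by
  constructor
  · simpa [of] using mk_rel k Rel.ba
  · simpa [of] using mk_rel k Rel.db
  · simpa [of] using mk_rel k Rel.ca
  · simpa [of] using mk_rel k Rel.dc
  · simpa [of] using mk_rel k Rel.bc
  · simpa [of] using mk_rel k Rel.aa
  · simpa [of] using mk_rel k Rel.bb
  · simpa [of] using mk_rel k Rel.cc
  · simpa [of] using mk_rel k Rel.dd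
  · simpa [of] using mk_rel k Rel.da

variable {k}

/-- Four elements of a `k`-algebra that satisfy the relations define an algebra map from `D_4`. -/
def lift {B : Type*} [Ring B] [Algebra k B] {a b c d : B} (h : Relations a b c d) :
    D4 k →ₐ[k] B :=
  RingQuot.liftAlgHom k
    ⟨FreeAlgebra.lift k (fun x => match x with | .a => a | .b => b | .c => c | .d => d), by
      intro x y hxy
      cases hxy <;> simp [h.ba, h.db, h.ca, h.dc, h.bc, h.aa, h.bb, h.cc, h.dd, h.da]⟩

section lift

variable {B : Type*} [Ring B] [Algebra k B] {a b c d : B} (h : Relations a b c d)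

@[simp] theorem lift_a : lift (k := k) h (of k .a) = a :=
  (RingQuot.liftAlgHom_mkAlgHom_apply k _ _ _).trans (by simp)
@[simp] theorem lift_b : lift (k := k) h (of k .b) = b :=
  (RingQuot.liftAlgHom_mkAlgHom_apply k _ _ _).trans (by simp)
@[simp] theorem lift_c : lift (k := k) h (of k .c) = c :=
  (RingQuot.liftAlgHom_mkAlgHom_apply k _ _ _).trans (by simp)
@[simp] theorem lift_d : lift (k := k) h (of k .d) = d :=
  (RingQuot.liftAlgHom_mkAlgHom_apply k _ _ _).trans (by simp)

end lift

theorem algHom_ext {B : Type*} [Semiring B] [Algebra k B] {f g : D4 k →ₐ[k] B}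
    (h : ∀ x, f (of k x) = g (of k x)) : f = g := by
  apply RingQuot.ringQuot_ext'
  apply FreeAlgebra.hom_ext
  funext x
  exact h x

variable (k)

theorem relations_comul : Relations (B := D4 k ⊗[k] D4 k)
    (of k .a ⊗ₜ of k .b + 1 ⊗ₜ of k .a) (of k .b ⊗ₜ of k .b) (of k .c ⊗ₜ of k .c)
    (of k .d ⊗ₜ of k .c + 1 ⊗ₜ of k .d) := by
  obtain ⟨ba, db, ca, dc, bc, aa, bb, cc, dd, da⟩ := relations_of k
  constructor <;>
    simp only [pow_two, mul_add, add_mul, Algebra.TensorProduct.tmul_mul_tmul, one_mul, mul_one]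
      at *
  · simp only [ba, TensorProduct.neg_tmul, TensorProduct.tmul_neg, neg_add]
  · simp only [db, bc, TensorProduct.neg_tmul, TensorProduct.tmul_neg, neg_add]
  · simp only [ca, bc, TensorProduct.neg_tmul, TensorProduct.tmul_neg, neg_add]
  · simp only [dc, TensorProduct.neg_tmul, TensorProduct.tmul_neg, neg_add]
  · simp only [bc]
  · simp only [aa, bb, ba, TensorProduct.zero_tmul, TensorProduct.tmul_zero,
      TensorProduct.tmul_neg]
    abel
  · simp only [bb]; rfl
  · simp only [cc]; rfl
  · simp only [dd, cc, dc, TensorProduct.zero_tmul, TensorProduct.tmul_zero,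
      TensorProduct.tmul_neg]
    abel
  · have e1 : of k .d * of k .a = 1 - of k .b * of k .c - of k .a * of k .d :=
      eq_sub_of_add_eq da
    simp only [e1, db, ca, ← bc, TensorProduct.sub_tmul, TensorProduct.tmul_sub,
      TensorProduct.tmul_neg, Algebra.TensorProduct.one_def]
    abel

/-- The comultiplication: `a ↦ a ⊗ b + 1 ⊗ a`, `b ↦ b ⊗ b`, `c ↦ c ⊗ c`, `d ↦ d ⊗ c + 1 ⊗ d`. -/
def comul : D4 k →ₐ[k] D4 k ⊗[k] D4 k := lift (relations_comul k)

theorem relations_counit : Relations (B := k) 0 1 1 0 := by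
  constructor <;> simp

/-- The counit: `a ↦ 0`, `b ↦ 1`, `c ↦ 1`, `d ↦ 0`. -/
def counit : D4 k →ₐ[k] k := lift (relations_counit k)

/-- The bialgebra structure of `D_4`. -/
instance : Bialgebra k (D4 k) :=
  Bialgebra.ofAlgHom (comul k) (counit k)
    (algHom_ext fun x => by
      cases x <;>
        simp [comul, TensorProduct.add_tmul, TensorProduct.tmul_add, Algebra.TensorProduct.one_def,
          add_assoc])
    (algHom_ext fun x => by
      cases x <;> simp [comul, counit])
    (algHom_ext fun x => by
      cases x <;> simp [comul, counit])

end Algebra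

end D4

/-! ### Tensor products of modules over a bialgebra -/

section Tensor

open scoped ModuleCat

/-- The tensor product over `k` of two modules over a `k`-bialgebra `A`, with the diagonal action
`h • (m ⊗ n) = ∑ h₁ m ⊗ h₂ n`, where `∑ h₁ ⊗ h₂` is the comultiplication of `h`. -/
noncomputable def tensorModule {k : Type u} [Field k] {A : Type u} [Ring A] [Bialgebra k A]
    (M N : ModuleCat.{u} A) : ModuleCat.{u} A :=
  letI : Module A (M ⊗[k] N) := Module.compHom (M ⊗[k] N)
    (((Module.endTensorEndAlgHom (R := k) (S := k) (A := k) (M := M) (N := N)).comp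
      (Algebra.TensorProduct.map (Algebra.lsmul k k M) (Algebra.lsmul k k N))).comp
        (Bialgebra.comulAlgHom k A)).toRingHom
  ModuleCat.of A (M ⊗[k] N)

end Tensor

/-! ### Injective envelopes and cosyzygies -/

section Cosyzygy

/-- `ι : M → I` is an injective envelope: `I` is injective, `ι` is a monomorphism and its image
is an essential submodule. -/
structure IsInjectiveEnvelope {A : Type u} [Ring A] {M I : Type u} [AddCommGroup M] [Module A M]
    [AddCommGroup I] [Module A I] (ι : M →ₗ[A] I) : Prop where
  injective : Module.Injective A I
  mono : Function.Injective ι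
  essential : ∀ S : Submodule A I, S ⊓ LinearMap.range ι = ⊥ → S = ⊥

/-- `N` is (isomorphic to) the `s`-th cosyzygy `Ω⁻ˢ M`: it arises from `M` by `s` times
passing from a module `L` to the cokernel of an injective envelope `L → I`. -/
def IsCosyzygy {A : Type u} [Ring A] : ℕ → ModuleCat.{u} A → ModuleCat.{u} A → Prop
  | 0, M, N => Nonempty (M ≃ₗ[A] N)
  | s + 1, M, N => ∃ L I : ModuleCat.{u} A, ∃ ι : L →ₗ[A] I,
      IsCosyzygy s M L ∧ IsInjectiveEnvelope ι ∧ Nonempty ((I ⧸ LinearMap.range ι) ≃ₗ[A] N)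

/-- Every module has an injective envelope. -/
theorem exists_isInjectiveEnvelope {A : Type u} [Ring A] (M : ModuleCat.{u} A) :
    ∃ (I : ModuleCat.{u} A) (ι : M →ₗ[A] I), IsInjectiveEnvelope ι := by
  -- embed `M` into an injective module `J`
  obtain ⟨J, hJ, f, hf⟩ : ∃ J : ModuleCat.{u} A, Module.Injective A J ∧
      ∃ f : M →ₗ[A] J, Function.Injective f := by
    obtain ⟨⟨J, hJ, f, hf⟩⟩ := CategoryTheory.EnoughInjectives.presentation M
    exact ⟨J, Module.injective_module_of_injective_object A J,
      f.hom, (ModuleCat.mono_iff_injective f).1 hf⟩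
  -- a maximal essential extension `E` of the image of `M` inside `J`
  let R := LinearMap.range f
  obtain ⟨E, hRE, hE⟩ := zorn_le_nonempty₀
    {E : Submodule A J | R ≤ E ∧ ∀ S : Submodule A J, S ≤ E → S ⊓ R = ⊥ → S = ⊥}
    (by
      intro c hc hchain y hy
      refine ⟨sSup c, ⟨(hc hy).1.trans (le_sSup hy), ?_⟩, fun z hz => le_sSup hz⟩
      intro S hS hSR
      rw [Submodule.eq_bot_iff]
      intro x hx
      obtain ⟨E', hE', hxE'⟩ := (Submodule.mem_sSup_of_directed ⟨y, hy⟩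
        hchain.directedOn).1 (hS hx)
      have h := (hc hE').2 (S ⊓ E') inf_le_right
        (le_bot_iff.1 ((inf_le_inf_right _ inf_le_left).trans hSR.le))
      exact (Submodule.eq_bot_iff _).1 h x ⟨hx, hxE'⟩)
    R ⟨le_rfl, fun S hS h => by rwa [inf_eq_left.2 hS] at h⟩
  obtain ⟨⟨-, hess⟩, hmax⟩ := hE
  -- a maximal submodule `C` with `C ⊓ E = ⊥`
  obtain ⟨C, -, hC⟩ := zorn_le_nonempty₀ {C : Submodule A J | C ⊓ E = ⊥}
    (by
      intro c hc hchain y hy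
      refine ⟨sSup c, ?_, fun z hz => le_sSup hz⟩
      change sSup c ⊓ E = ⊥
      rw [Submodule.eq_bot_iff]
      rintro x ⟨hx, hxE⟩
      obtain ⟨C', hC', hxC'⟩ := (Submodule.mem_sSup_of_directed ⟨y, hy⟩
        hchain.directedOn).1 hx
      exact (Submodule.eq_bot_iff _).1 (hc hC') x ⟨hxC', hxE⟩)
    ⊥ (bot_inf_eq E)
  obtain ⟨hCE, hCmax⟩ := hC
  change C ⊓ E = ⊥ at hCE
  let q : E →ₗ[A] J ⧸ C := C.mkQ ∘ₗ E.subtype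
  have hq : Function.Injective q := by
    rw [← LinearMap.ker_eq_bot, Submodule.eq_bot_iff]
    intro x hx
    have : (x : J) ∈ C ⊓ E := ⟨by simpa [q] using hx, x.2⟩
    rw [hCE] at this
    exact Subtype.ext (by simpa using this)
  -- extend the inclusion of `E` to `g : J ⧸ C → J`
  obtain ⟨g, hg⟩ := hJ.out q hq E.subtype
  -- submodules of `J ⧸ C` that avoid the image of `E` vanish
  have hqess : ∀ S : Submodule A (J ⧸ C), (∀ e : E, q e ∈ S → e = 0) → S = ⊥ := by
    intro S hS
    have hle : C ≤ S.comap C.mkQ := fun x hx => by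
      have : C.mkQ x = 0 := by simpa using hx
      simp [Submodule.mem_comap, -Submodule.mkQ_apply, this]
    have h1 : S.comap C.mkQ ⊓ E = ⊥ := by
      rw [Submodule.eq_bot_iff]
      rintro x ⟨hx, hxE⟩
      exact congrArg Subtype.val (hS ⟨x, hxE⟩ hx)
    have h2 : S.comap C.mkQ ≤ C := hCmax h1 hle
    rw [Submodule.eq_bot_iff]
    intro y hy
    obtain ⟨x, rfl⟩ := C.mkQ_surjective y
    simpa using h2 hy
  have hgker : LinearMap.ker g = ⊥ := hqess _ fun e he => by
    have := hg e
    rw [LinearMap.mem_ker.1 he] at this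
    exact Subtype.ext this.symm
  have hEg : E ≤ LinearMap.range g := fun x hx => ⟨q ⟨x, hx⟩, hg ⟨x, hx⟩⟩
  -- the image of `g` is essential over `R`, so equals `E` by maximality
  have hgE : LinearMap.range g ≤ E := by
    refine hmax ⟨hRE.trans hEg, ?_⟩ hEg
    intro S hS hSR
    have h0 : S ⊓ E = ⊥ := hess _ inf_le_right
      (le_bot_iff.1 ((inf_le_inf_right _ inf_le_left).trans hSR.le))
    have h1 : S.comap g = ⊥ := hqess _ fun e he => by
      have h2 : (e : J) ∈ S ⊓ E := ⟨by
        have h3 : g (q e) ∈ S := he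
        rwa [hg e] at h3, e.2⟩
      rw [h0] at h2
      exact Subtype.ext (by simpa using h2)
    rw [Submodule.eq_bot_iff]
    intro x hx
    obtain ⟨y, rfl⟩ := hS hx
    have : y ∈ S.comap g := hx
    rw [h1] at this
    rw [(Submodule.mem_bot A).1 this, map_zero]
  -- so `E` is a retract of `J`
  let p : J →ₗ[A] E := LinearMap.codRestrict E (g ∘ₗ C.mkQ) fun x => hgE ⟨_, rfl⟩
  have hp : ∀ e : E, p e = e := fun e => Subtype.ext (hg e)
  refine ⟨ModuleCat.of A E, LinearMap.codRestrict E f fun x => hRE ⟨x, rfl⟩, ?_, ?_, ?_⟩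
  · refine ⟨fun X Y _ _ _ _ i hi h => ?_⟩
    obtain ⟨h', hh'⟩ := hJ.out i hi (E.subtype ∘ₗ h)
    exact ⟨p ∘ₗ h', fun x => by
      rw [LinearMap.comp_apply, hh']
      exact hp (h x)⟩
  · intro x y hxy
    exact hf (congrArg Subtype.val hxy)
  · intro S hS
    have h1 : S.map E.subtype = ⊥ := by
      refine hess _ (Submodule.map_subtype_le E S) ?_
      rw [Submodule.eq_bot_iff]
      rintro _ ⟨⟨e, he, rfl⟩, m, hm⟩
      have h2 : e ∈ S ⊓ LinearMap.range (LinearMap.codRestrict E f fun x => hRE ⟨x, rfl⟩) :=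
        ⟨he, m, Subtype.ext hm⟩
      rw [hS] at h2
      rw [(Submodule.mem_bot A).1 h2, map_zero]
    rw [Submodule.eq_bot_iff]
    intro e he
    have h2 : (e : J) ∈ S.map E.subtype := ⟨e, he, rfl⟩
    rw [h1] at h2
    exact Subtype.ext ((Submodule.mem_bot A).1 h2)

/-- Cosyzygies of every order exist. -/
theorem exists_isCosyzygy {A : Type u} [Ring A] (s : ℕ) (M : ModuleCat.{u} A) :
    ∃ N : ModuleCat.{u} A, IsCosyzygy s M N := by
  induction s with
  | zero => exact ⟨M, ⟨LinearEquiv.refl A M⟩⟩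
  | succ s ih =>
    obtain ⟨L, hL⟩ := ih
    obtain ⟨I, ι, hι⟩ := exists_isInjectiveEnvelope L
    exact ⟨ModuleCat.of A (I ⧸ LinearMap.range ι), L, I, ι, hL, hι, ⟨LinearEquiv.refl A _⟩⟩

end Cosyzygy

/-! ### The modules `V(r)`, `P(r)` and `M_t(r, η)` -/

namespace D4

section Modules

variable {k : Type u} [Field k]

/-- The `D_4`-module on a `k`-space `X` on which the generators act by `a, b, c, d`. -/
def moduleOf {X : Type u} [AddCommGroup X] [Module k X] {a b c d : Module.End k X}
    (h : Relations a b c d) : ModuleCat.{u} (D4 k) :=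
  letI : Module (D4 k) X := Module.compHom X (lift (k := k) h).toRingHom
  ModuleCat.of (D4 k) X

variable (k)

/-- The scalar `(-1)^r` for `r ∈ ℤ/2`. -/
def sgn (r : ZMod 2) : k := if r = 0 then 1 else -1

theorem sgn_mul_self (r : ZMod 2) : sgn k r * sgn k r = 1 := by
  unfold sgn; split_ifs <;> simp

theorem sgn_add_one (r : ZMod 2) : sgn k (r + 1) = -sgn k r := by
  have h : ∀ r : ZMod 2, r + 1 = 0 ↔ r ≠ 0 := by decide
  unfold sgn
  by_cases hr : r = 0 <;> simp [hr, h]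

theorem relations_V (r : ZMod 2) : Relations (B := Module.End k k)
    0 (sgn k r • 1) (sgn k r • 1) 0 := by
  constructor <;> simp [pow_two, sgn_mul_self, smul_smul]

/-- The one-dimensional simple module `V(r)`: `a, d` act by `0` and `b, c` by `(-1)^r`. -/
def V (r : ZMod 2) : ModuleCat.{u} (D4 k) := moduleOf (relations_V k r)

/-- The matrices of the generators on `P(r)` in the standard basis `v_1, v_2, v_3, v_4`
(the columns are the images of the basis vectors):
`a v_1 = v_2`, `a v_3 = v_4`, `a v_2 = a v_4 = 0`. -/
def Pa : Matrix (Fin 4) (Fin 4) k :=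
  !![0, 0, 0, 0;
     1, 0, 0, 0;
     0, 0, 0, 0;
     0, 0, 1, 0]

/-- `d v_1 = v_3`, `d v_2 = -v_4`, `d v_3 = d v_4 = 0`. -/
def Pd : Matrix (Fin 4) (Fin 4) k :=
  !![0, 0, 0, 0;
     0, 0, 0, 0;
     1, 0, 0, 0;
     0, -1, 0, 0]

/-- `b` and `c` act on `v_1, v_4` by `(-1)^r` and on `v_2, v_3` by `(-1)^(r+1)`. -/
def Pb (r : ZMod 2) : Matrix (Fin 4) (Fin 4) k :=
  Matrix.diagonal ![sgn k r, sgn k (r + 1), sgn k (r + 1), sgn k r]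

theorem relations_P_matrix (r : ZMod 2) : Relations (Pa k) (Pb k r) (Pb k r) (Pd k) := by
  have h := sgn_mul_self k r
  constructor <;>
  · ext i j
    fin_cases i <;> fin_cases j <;>
      simp [Pa, Pb, Pd, pow_two, Matrix.mul_apply, Fin.sum_univ_four, sgn_add_one, h,
        Matrix.vecMul_diagonal]

theorem relations_map {B C : Type*} [Ring B] [Ring C] (f : B →+* C) {a b c d : B}
    (h : Relations a b c d) : Relations (f a) (f b) (f c) (f d) := by
  constructor
  · simpa using congrArg f h.ba
  · simpa using congrArg f h.db
  · simpa using congrArg f h.ca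
  · simpa using congrArg f h.dc
  · simpa using congrArg f h.bc
  · simpa using congrArg f h.aa
  · simpa using congrArg f h.bb
  · simpa using congrArg f h.cc
  · simpa using congrArg f h.dd
  · simpa using congrArg f h.da

/-- The four-dimensional module `P(r)`, the projective cover of `V(r)`. -/
def P (r : ZMod 2) : ModuleCat.{u} (D4 k) :=
  moduleOf (relations_map (Matrix.toLinAlgEquiv' (R := k) (n := Fin 4)).toAlgHom.toRingHom
    (relations_P_matrix k r))

/-- The nilpotent Jordan block of size `t`, as an endomorphism of `k^t`: it sends the `i`-th
standard basis vector to the `(i-1)`-st one, and the first one to `0`. -/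
def shift (t : ℕ) : Module.End k (Fin t → k) :=
  Matrix.toLin' (Matrix.of fun j i : Fin t => if (j : ℕ) + 1 = i then 1 else 0)

variable {k}

/-- For `T : X → X`, the endomorphism `(x, y) ↦ (0, T x)` of `X × X`. -/
def lower {X : Type*} [AddCommGroup X] [Module k X] (T : Module.End k X) :
    Module.End k (X × X) :=
  LinearMap.inr k X X ∘ₗ T ∘ₗ LinearMap.fst k X X

/-- The endomorphism `(x, y) ↦ ((-1)^(r+1) x, (-1)^r y)` of `X × X`. -/
def grading (k : Type u) [Field k] (X : Type*) [AddCommGroup X] [Module k X] (r : ZMod 2) :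
    Module.End k (X × X) :=
  LinearMap.prodMap (sgn k (r + 1) • LinearMap.id) (sgn k r • LinearMap.id)

theorem relations_M {X : Type*} [AddCommGroup X] [Module k X] (T U : Module.End k X)
    (r : ZMod 2) :
    Relations (lower T) (grading k X r) (grading k X r) (lower U) := by
  have h := sgn_mul_self k r
  constructor <;>
  · ext x <;>
      simp [lower, grading, pow_two, sgn_add_one, smul_smul, h]

/-- How `a` sends the span of the `v_{1,i}` to the span of the `v_{2,i}` in `M_t(r, η)`:
`v_{1,i} ↦ v_{2,i}` if `η ∈ k`, and `v_{1,i} ↦ v_{2,i-1}` (`0` for `i = 1`) if `η = ∞`. -/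
def aMap (t : ℕ) : OnePoint k → Module.End k (Fin t → k)
  | some _ => 1
  | none => shift k t

/-- How `d` sends the span of the `v_{1,i}` to the span of the `v_{2,i}` in `M_t(r, η)`:
`v_{1,i} ↦ -v_{2,i-1} - η v_{2,i}` if `η ∈ k` (without the first term for `i = 1`), and
`v_{1,i} ↦ v_{2,i}` if `η = ∞`. -/
def dMap (t : ℕ) : OnePoint k → Module.End k (Fin t → k)
  | some η => -shift k t - η • 1
  | none => 1

/-- The `2t`-dimensional module `M_t(r, η)`, for `η` in the projective line `k ∪ {∞}`, with its
standard basis `v_{1,1}, …, v_{1,t}, v_{2,1}, …, v_{2,t}`: here `v_{1,i}` and `v_{2,i}` are the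
standard basis vectors of the first and of the second factor of `k^t × k^t`. The generators `a`
and `d` kill all `v_{2,i}` and send the `v_{1,i}` to the span of the `v_{2,i}` by `aMap` and `dMap`;
`b` and `c` act on the `v_{1,i}` by `(-1)^(r+1)` and on the `v_{2,i}` by `(-1)^r`. -/
def M (t : ℕ) (r : ZMod 2) (η : OnePoint k) : ModuleCat.{u} (D4 k) :=
  moduleOf (relations_M (aMap t η) (dMap t η) r)

end Modules

end D4

/-! Apart from P(r), all the modules involved are pencils: a and d act through two linear maps α, δ
: E → F, while b and c act by opposite signs on E and F. If α and δ have no common kernel, the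
pencil has socle F and injective envelope F ⊗ P(r). The cokernel is again a pencil F → F', with F'
the quotient of F × F by the pairs (-δe, αe). Starting from V(r), where E = 0 and F = k, this
recursion (`isCosyzygy_pencil_succ`) identifies Ω⁻ˢV(r) with the polynomials of degree < s, mapped
to those of degree ≤ s by inclusion and by multiplication by x.

M_t(r, η) is a pencil A, D on X = k^t in which one map is the identity and the other is some T. The
tensor product with Ω⁻ˢV(r') has two natural quotients. Evaluation x ⊗ p ↦ p(T)x maps it to the
pencil A, D. A map to U ⊗ P is determined by its socle component, which may be any linear map
compatible with b and c (`homEnv`, `hom_env_apply`). For U = X ⊗ E, p ↦ (p - p(0))/x applied to the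
component X ⊗ F is such a map.

Together the two maps are injective, because p ↦ (p - p(0))/x is nilpotent on E, and because p is
recovered from (p - p(0))/x and its value at T. Since 2t(2s+1) = 4st + 2t, they form an isomorphism
(`tensor_pencil_equiv`). -/

namespace D4

/-! ### Linear maps between modules given by operators -/

section Framework

variable {k : Type u} [Field k]

/-- Induction on elements of `D_4`. -/
theorem induction_on {p : D4 k → Prop} (x : D4 k)
    (scalar : ∀ r : k, p (algebraMap k (D4 k) r)) (gens : ∀ g, p (of k g))
    (mul : ∀ x y, p x → p y → p (x * y)) (add : ∀ x y, p x → p y → p (x + y)) : p x := by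
  obtain ⟨y, rfl⟩ : ∃ y, mk k y = x := RingQuot.mkAlgHom_surjective k (Rel k) x
  induction y using FreeAlgebra.induction with
  | grade0 r => simpa using scalar r
  | grade1 g => exact gens g
  | mul x y hx hy => rw [map_mul]; exact mul _ _ hx hy
  | add x y hx hy => rw [map_add]; exact add _ _ hx hy

/-- An additive map that commutes with scalars and with the generators is `D_4`-linear. -/
def homOfGen {X Y : Type*} [AddCommGroup X] [Module (D4 k) X] [AddCommGroup Y] [Module (D4 k) Y]
    (f : X →+ Y)
    (hs : ∀ (r : k) x, f (algebraMap k (D4 k) r • x) = algebraMap k (D4 k) r • f x)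
    (hg : ∀ g x, f (of k g • x) = of k g • f x) : X →ₗ[D4 k] Y where
  toFun := f
  map_add' := f.map_add
  map_smul' u := by
    induction u using induction_on with
    | scalar r => exact hs r
    | gens g => exact hg g
    | mul x y hx hy => intro z; simp only [mul_smul, RingHom.id_apply] at *; rw [hx, hy]
    | add x y hx hy => intro z; simp only [add_smul, map_add, RingHom.id_apply] at *; rw [hx, hy]

@[simp] theorem homOfGen_apply {X Y : Type*} [AddCommGroup X] [Module (D4 k) X] [AddCommGroup Y]
    [Module (D4 k) Y] (f : X →+ Y) (hs) (hg) (x : X) : homOfGen (k := k) f hs hg x = f x := rfl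

/-- Four elements `a, b, c, d` as a family indexed by the generators. -/
def action {B : Type*} (a b c d : B) : D4Gen → B
  | .a => a
  | .b => b
  | .c => c
  | .d => d

variable {X Y : Type u} [AddCommGroup X] [Module k X] [AddCommGroup Y] [Module k Y]
  {a b c d : Module.End k X} {a' b' c' d' : Module.End k Y}

/-- The identity, from `moduleOf h` to the space on which it is defined. -/
def moduleOfId (h : Relations a b c d) : moduleOf h ≃+ X := AddEquiv.refl X

theorem moduleOfId_algebraMap_smul (h : Relations a b c d) (r : k) (x : moduleOf h) :
    moduleOfId h (algebraMap k (D4 k) r • x) = r • moduleOfId h x := by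
  change lift (k := k) h (algebraMap k (D4 k) r) (moduleOfId h x) = _
  rw [AlgHom.commutes]
  rfl

theorem moduleOfId_of_smul (h : Relations a b c d) (g : D4Gen) (x : moduleOf h) :
    moduleOfId h (of k g • x) = action a b c d g (moduleOfId h x) := by
  change lift (k := k) h (of k g) (moduleOfId h x) = _
  cases g <;> simp [action]

/-- An intertwining `k`-linear map is `D_4`-linear. -/
def moduleOfHom (h : Relations a b c d) (h' : Relations a' b' c' d') (f : X →ₗ[k] Y)
    (hf : ∀ g x, f (action a b c d g x) = action a' b' c' d' g (f x)) :
    moduleOf h →ₗ[D4 k] moduleOf h' :=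
  homOfGen ((moduleOfId h').symm.toAddMonoidHom.comp
      (f.toAddMonoidHom.comp (moduleOfId h).toAddMonoidHom))
    (fun r x => (moduleOfId h').injective (by
      simp [moduleOfId_algebraMap_smul]))
    (fun g x => (moduleOfId h').injective (by
      simp [moduleOfId_of_smul, hf]))

@[simp] theorem moduleOfId_moduleOfHom (h : Relations a b c d) (h' : Relations a' b' c' d')
    (f : X →ₗ[k] Y) (hf) (x : moduleOf h) :
    moduleOfId h' (moduleOfHom h h' f hf x) = f (moduleOfId h x) := rfl

/-- An intertwining `k`-linear equivalence is a `D_4`-linear equivalence. -/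
noncomputable def moduleOfEquiv (h : Relations a b c d) (h' : Relations a' b' c' d')
    (f : X →ₗ[k] Y) (hf : ∀ g x, f (action a b c d g x) = action a' b' c' d' g (f x))
    (hb : Function.Bijective f) : moduleOf h ≃ₗ[D4 k] moduleOf h' :=
  LinearEquiv.ofBijective (moduleOfHom h h' f hf) hb

end Framework

/-! ### Tensor products of modules given by operators -/

section TensorProduct

open scoped ModuleCat

variable {k : Type u} [Field k]

/-- The identity, from `tensorModule M N` to the tensor product. -/
noncomputable def tensorId {A : Type u} [Ring A] [Bialgebra k A] (M N : ModuleCat.{u} A) :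
    tensorModule (k := k) M N ≃+ M ⊗[k] N := AddEquiv.refl (M ⊗[k] N)

theorem tensorId_smul {A : Type u} [Ring A] [Bialgebra k A] (M N : ModuleCat.{u} A)
    (x : A) (z : tensorModule (k := k) M N) :
    tensorId M N (x • z) =
      Module.endTensorEndAlgHom (R := k) (S := k) (A := k) (M := M) (N := N)
        (Algebra.TensorProduct.map (Algebra.lsmul k k M) (Algebra.lsmul k k N)
          (Bialgebra.comulAlgHom k A x)) (tensorId M N z) := rfl

theorem comulAlgHom_of (g : D4Gen) : Bialgebra.comulAlgHom k (D4 k) (of k g) =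
    action (of k .a ⊗ₜ of k .b + 1 ⊗ₜ of k .a) (of k .b ⊗ₜ of k .b) (of k .c ⊗ₜ of k .c)
    (of k .d ⊗ₜ of k .c + 1 ⊗ₜ of k .d) g := by
  change comul k (of k g) = _
  cases g <;> simp [comul, action]

/-- The tensor product respects isomorphisms in the second factor. -/
theorem tensorModule_congr_right {A : Type u} [Ring A] [Bialgebra k A] (M : ModuleCat.{u} A)
    {N N' : ModuleCat.{u} A} (e : N ≃ₗ[A] N') :
    Nonempty (tensorModule (k := k) M N ≃ₗ[A] tensorModule (k := k) M N') := by
  let E : M ⊗[k] N ≃ₗ[k] M ⊗[k] N' :=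
    TensorProduct.congr (LinearEquiv.refl k M) (e.restrictScalars k)
  refine ⟨{ (tensorId M N).trans (E.toAddEquiv.trans (tensorId M N').symm) with
    map_smul' := fun x z => (tensorId M N').injective ?_ }⟩
  change tensorId M N' ((tensorId M N').symm (E (tensorId M N (x • z)))) =
    tensorId M N' (x • (tensorId M N').symm (E (tensorId M N z)))
  rw [tensorId_smul, tensorId_smul, AddEquiv.apply_symm_apply, AddEquiv.apply_symm_apply]
  generalize tensorId M N z = z
  generalize Bialgebra.comulAlgHom k A x = y
  induction y with
  | zero => simp
  | add y y' h h' => simp only [map_add, LinearMap.add_apply, h, h']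
  | tmul y y' =>
    induction z with
    | zero => simp
    | add z z' h h' => simp only [map_add, h, h']
    | tmul m n => simp [E, Module.endTensorEndAlgHom_apply]

variable {X Y : Type u} [AddCommGroup X] [Module k X] [AddCommGroup Y] [Module k Y]
  {a b c d : Module.End k X} {a' b' c' d' : Module.End k Y}

-- No computation is needed: the four operators are the images of the coproducts of the generators,
-- and `relations_comul` is transported along an algebra map.
open _root_.TensorProduct in
theorem relations_tensor (h : Relations a b c d) (h' : Relations a' b' c' d') :
    Relations (B := Module.End k (X ⊗[k] Y))
      (map a b' + map 1 a') (map b b') (map c c') (map d c' + map 1 d') := by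
  have := relations_map ((Module.endTensorEndAlgHom (R := k) (S := k) (A := k) (M := X)
    (N := Y)).comp (Algebra.TensorProduct.map (lift (k := k) h) (lift (k := k) h'))).toRingHom
      (relations_comul k)
  simpa [Module.endTensorEndAlgHom_apply, AlgebraTensorModule.map_eq] using this

/-- The identity, as a `k`-linear map from `moduleOf h` to the space on which it is defined. -/
def moduleOfLinearId (h : Relations a b c d) : moduleOf h ≃ₗ[k] X :=
  { moduleOfId h with map_smul' := moduleOfId_algebraMap_smul h }

/-- The tensor product of two modules that are given by operators. -/
theorem tensorModule_moduleOf (h : Relations a b c d) (h' : Relations a' b' c' d') :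
    Nonempty (tensorModule (k := k) (moduleOf h) (moduleOf h') ≃ₗ[D4 k]
      moduleOf (relations_tensor h h')) := by
  let E : moduleOf h ⊗[k] moduleOf h' ≃ₗ[k] X ⊗[k] Y :=
    TensorProduct.congr (moduleOfLinearId h) (moduleOfLinearId h')
  let F := ((tensorId (moduleOf h) (moduleOf h')).trans (E.toAddEquiv.trans
    (moduleOfId (relations_tensor h h')).symm))
  have hF : ∀ z, moduleOfId (relations_tensor h h') (F z) =
    E (tensorId (moduleOf h) (moduleOf h') z) := fun _ => rfl
  let f : tensorModule (k := k) (moduleOf h) (moduleOf h') →ₗ[D4 k]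
      moduleOf (relations_tensor h h') :=
    homOfGen F.toAddMonoidHom (by
        intro r x
        apply (moduleOfId (relations_tensor h h')).injective
        change moduleOfId (relations_tensor h h') (F _) =
          moduleOfId (relations_tensor h h') (_ • F x)
        rw [moduleOfId_algebraMap_smul, hF, hF, tensorId_smul]
        simp only [AlgHom.commutes]
        exact E.map_smul r _) (by
        intro g x
        apply (moduleOfId (relations_tensor h h')).injective
        change moduleOfId (relations_tensor h h') (F _) =
          moduleOfId (relations_tensor h h') (_ • F x)
        rw [moduleOfId_of_smul, hF, hF, tensorId_smul, comulAlgHom_of]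
        generalize tensorId (moduleOf h) (moduleOf h') x = z
        induction z with
        | zero => simp
        | add z z' h h' => simp only [map_add, h, h']
        | tmul m n =>
          have h1 : ∀ g, moduleOfLinearId h (of k g • m) = _ := fun g => moduleOfId_of_smul h g m
          have h2 : ∀ g, moduleOfLinearId h' (of k g • n) = _ := fun g => moduleOfId_of_smul h' g n
          have h3 : ∀ m, moduleOfId h m = moduleOfLinearId h m := fun _ => rfl
          have h4 : ∀ m, moduleOfId h' m = moduleOfLinearId h' m := fun _ => rfl
          cases g <;> simp [E, Module.endTensorEndAlgHom_apply, action, h1, h2, h3, h4])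
  exact ⟨LinearEquiv.ofBijective f F.bijective⟩

end TensorProduct

end D4

/-! ### Uniqueness of cosyzygies -/

section Uniqueness

variable {A : Type u} [Ring A]

/-- The cokernels of injective envelopes of isomorphic modules are isomorphic. -/
theorem IsInjectiveEnvelope.nonempty_quotient_equiv {L L' I I' : Type u}
    [AddCommGroup L] [Module A L] [AddCommGroup L'] [Module A L'] [AddCommGroup I] [Module A I]
    [AddCommGroup I'] [Module A I'] {ι : L →ₗ[A] I} {ι' : L' →ₗ[A] I'}
    (h : IsInjectiveEnvelope ι) (h' : IsInjectiveEnvelope ι') (e : L ≃ₗ[A] L') :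
    Nonempty ((I ⧸ LinearMap.range ι) ≃ₗ[A] (I' ⧸ LinearMap.range ι')) := by
  obtain ⟨g, hg⟩ := h'.injective.out ι h.mono (ι' ∘ₗ e.toLinearMap)
  -- The kernel of g meets the image of ι trivially, so essentiality kills it.
  have hg_inj : Function.Injective g := by
    rw [← LinearMap.ker_eq_bot]
    refine h.essential _ ((Submodule.eq_bot_iff _).2 ?_)
    rintro _ ⟨hx, l, rfl⟩
    have hx' : g (ι l) = 0 := hx
    rw [hg] at hx'
    have : e l = 0 := h'.mono (by simpa using hx')
    rw [e.map_eq_zero_iff.1 this, map_zero]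
  obtain ⟨p, hp⟩ := h.injective.out g hg_inj LinearMap.id
  -- The image of ι' lies in the image of g, where the retraction p is injective; essentiality of ι'
  -- then makes p injective everywhere, which forces g to be onto.
  have hp_inj : Function.Injective p := by
    rw [← LinearMap.ker_eq_bot]
    refine h'.essential _ ((Submodule.eq_bot_iff _).2 ?_)
    rintro _ ⟨hx, l, rfl⟩
    have hx' : p (ι' l) = 0 := hx
    have h1 : ι' l = g (ι (e.symm l)) := by simp [hg]
    rw [h1, hp] at hx'
    have h2 : ι (e.symm l) = 0 := hx'
    rw [h1, h2, map_zero]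
  have hg_surj : Function.Surjective g := fun y => ⟨p y, hp_inj (hp (p y))⟩
  refine ⟨Submodule.Quotient.equiv _ _ (LinearEquiv.ofBijective g ⟨hg_inj, hg_surj⟩) ?_⟩
  ext y
  constructor
  · rintro ⟨_, ⟨l, rfl⟩, rfl⟩
    exact ⟨e l, (hg l).symm⟩
  · rintro ⟨l, rfl⟩
    exact ⟨ι (e.symm l), ⟨_, rfl⟩, (hg (e.symm l)).trans (by simp)⟩

/-- Cosyzygies are unique up to isomorphism. -/
theorem IsCosyzygy.nonempty_equiv {s : ℕ} {M N N' : ModuleCat.{u} A} (h : IsCosyzygy s M N)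
    (h' : IsCosyzygy s M N') : Nonempty (N ≃ₗ[A] N') := by
  induction s generalizing N N' with
  | zero =>
    obtain ⟨e⟩ := h
    obtain ⟨e'⟩ := h'
    exact ⟨e.symm.trans e'⟩
  | succ s ih =>
    obtain ⟨L, I, ι, hL, hι, ⟨e⟩⟩ := h
    obtain ⟨L', I', ι', hL', hι', ⟨e'⟩⟩ := h'
    obtain ⟨f⟩ := ih hL hL'
    obtain ⟨g⟩ := hι.nonempty_quotient_equiv hι' f
    exact ⟨(e.symm.trans g).trans e'⟩

end Uniqueness

namespace D4

variable {k : Type u} [Field k]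

/-! ### Modules given by a pair of linear maps -/

section Pencil

variable {E F : Type u} [AddCommGroup E] [Module k E] [AddCommGroup F] [Module k F]

/-- For `T : E → F`, the endomorphism `(x, y) ↦ (0, T x)` of `E × F`. -/
def lowerMap (T : E →ₗ[k] F) : Module.End k (E × F) :=
  LinearMap.inr k E F ∘ₗ T ∘ₗ LinearMap.fst k E F

variable (k E F) in
/-- The endomorphism `(x, y) ↦ ((-1)^(r+1) x, (-1)^r y)` of `E × F`. -/
def gradingMap (r : ZMod 2) : Module.End k (E × F) :=
  LinearMap.prodMap (sgn k (r + 1) • LinearMap.id) (sgn k r • LinearMap.id)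

@[simp] theorem lowerMap_apply (T : E →ₗ[k] F) (x : E × F) : lowerMap T x = (0, T x.1) := rfl

@[simp] theorem gradingMap_apply (r : ZMod 2) (x : E × F) :
    gradingMap k E F r x = (sgn k (r + 1) • x.1, sgn k r • x.2) := rfl

theorem relations_pencil (α δ : E →ₗ[k] F) (r : ZMod 2) :
    Relations (lowerMap α) (gradingMap k E F r) (gradingMap k E F r) (lowerMap δ) := by
  have h := sgn_mul_self k r
  constructor <;>
  · ext x <;> simp [pow_two, sgn_add_one, smul_smul, h]

/-- The `D_4`-module of Loewy length two given by a pair of linear maps `α, δ : E → F`. -/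
abbrev pencil (α δ : E →ₗ[k] F) (r : ZMod 2) : ModuleCat.{u} (D4 k) :=
  moduleOf (relations_pencil α δ r)

end Pencil

/-! ### Sums of copies of P(r), and their injectivity -/

section Envelope

variable (U : Type u) [AddCommGroup U] [Module k U]

/-- The action of `a` on `U ⊗ P(r)`, written as `U × U × U × U`. -/
def envA : Module.End k (U × U × U × U) where
  toFun x := (0, x.1, 0, x.2.2.1)
  map_add' x y := by simp
  map_smul' c x := by simp

/-- The action of `d` on `U ⊗ P(r)`, written as `U × U × U × U`. -/
def envD : Module.End k (U × U × U × U) where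
  toFun x := (0, 0, x.1, -x.2.1)
  map_add' x y := by simp [add_comm]
  map_smul' c x := by simp

/-- The action of `b` and `c` on `U ⊗ P(r)`, written as `U × U × U × U`. -/
def envB (r : ZMod 2) : Module.End k (U × U × U × U) where
  toFun x := (sgn k r • x.1, sgn k (r + 1) • x.2.1, sgn k (r + 1) • x.2.2.1, sgn k r • x.2.2.2)
  map_add' x y := by simp
  map_smul' c x := by simp [smul_comm c]

variable {U}

@[simp] theorem envA_apply (x : U × U × U × U) : envA (k := k) U x = (0, x.1, 0, x.2.2.1) := rfl
@[simp] theorem envD_apply (x : U × U × U × U) : envD (k := k) U x = (0, 0, x.1, -x.2.1) := rfl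
@[simp] theorem envB_apply (r : ZMod 2) (x : U × U × U × U) : envB (k := k) U r x =
  (sgn k r • x.1, sgn k (r + 1) • x.2.1, sgn k (r + 1) • x.2.2.1, sgn k r • x.2.2.2) := rfl

variable (k U)

theorem relations_env (r : ZMod 2) :
    Relations (envA (k := k) U) (envB U r) (envB U r) (envD U) := by
  have h := sgn_mul_self k r
  constructor <;>
  · refine LinearMap.ext fun x => ?_
    simp [pow_two, sgn_add_one, smul_smul, h]

/-- The direct sum of copies of `P(r)` indexed by a basis of `U`. -/
abbrev env (r : ZMod 2) : ModuleCat.{u} (D4 k) := moduleOf (relations_env k U r)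

variable {k} {T : Type u} [AddCommGroup T] [Module (D4 k) T]

theorem smul_algebraMap_comm (x : D4 k) (c : k) (z : T) :
    x • algebraMap k (D4 k) c • z = algebraMap k (D4 k) c • x • z := by
  rw [← mul_smul, ← mul_smul, Algebra.commutes]

variable {U}

/-- The map to `U ⊗ P(r)` given by its component in the socle, as an additive map. -/
def homEnvAux (φ : T →+ U) : T →+ U × U × U × U where
  toFun x := (-φ (of k .d • of k .a • x), -φ (of k .d • x), φ (of k .a • x), φ x)
  map_zero' := by simp
  map_add' x y := by simp [add_comm]

@[simp] theorem homEnvAux_apply (φ : T →+ U) (x : T) : homEnvAux (k := k) φ x =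
  (-φ (of k .d • of k .a • x), -φ (of k .d • x), φ (of k .a • x), φ x) := rfl

/-- The map to `U ⊗ P(r)` given by its component in the socle. -/
def homEnv (r : ZMod 2) (φ : T →+ U) (hs : ∀ (c : k) x, φ (algebraMap k (D4 k) c • x) = c • φ x)
    (hb : ∀ x, φ (of k .b • x) = sgn k r • φ x) (hc : ∀ x, φ (of k .c • x) = sgn k r • φ x) :
    T →ₗ[D4 k] env k U r :=
  homOfGen ((moduleOfId (relations_env k U r)).symm.toAddMonoidHom.comp (homEnvAux (k := k) φ))
    (fun c x => (moduleOfId (relations_env k U r)).injective (by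
      simp [moduleOfId_algebraMap_smul, hs, smul_algebraMap_comm]))
    (fun g x => (moduleOfId (relations_env k U r)).injective (by
      obtain ⟨ba, db, ca, dc, bc, aa, bb, cc, dd, da⟩ := relations_of k
      have h1 : ∀ z : T, of k .a • of k .a • z = 0 := fun z => by
        rw [← mul_smul, ← pow_two, aa, zero_smul]
      have h2 : ∀ z : T, of k .d • of k .d • z = 0 := fun z => by
        rw [← mul_smul, ← pow_two, dd, zero_smul]
      have h3 : ∀ z : T, of k .a • of k .b • z = -(of k .b • of k .a • z) := fun z => by
        rw [← mul_smul, ← mul_smul, ba, neg_smul, neg_neg]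
      have h4 : ∀ z : T, of k .a • of k .c • z = -(of k .c • of k .a • z) := fun z => by
        rw [← mul_smul, ← mul_smul, ca, neg_smul, neg_neg]
      have h5 : ∀ z : T, of k .d • of k .b • z = -(of k .b • of k .d • z) := fun z => by
        rw [← mul_smul, ← mul_smul, db, neg_smul]
      have h6 : ∀ z : T, of k .d • of k .c • z = -(of k .c • of k .d • z) := fun z => by
        rw [← mul_smul, ← mul_smul, dc, neg_smul]
      -- φ kills the image of da + ad = 1 - bc, since b and c act on its values by the same sign.
      have h7 : ∀ z : T, φ (of k .d • of k .a • z) = -φ (of k .a • of k .d • z) := fun z => by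
        rw [eq_neg_iff_add_eq_zero, ← map_add, ← mul_smul, ← mul_smul, ← add_smul, da, sub_smul,
          mul_smul, map_sub, hb, hc, smul_smul, sgn_mul_self, one_smul, one_smul, sub_self]
      rw [moduleOfId_of_smul]
      cases g <;> simp [action, h1, h2, h3, h4, h5, h6, h7, hb, hc, sgn_add_one]))

@[simp] theorem moduleOfId_homEnv (r : ZMod 2) (φ : T →+ U) (hs) (hb) (hc) (x : T) :
    moduleOfId (relations_env k U r) (homEnv r φ hs hb hc x) =
      (-φ (of k .d • of k .a • x), -φ (of k .d • x), φ (of k .a • x), φ x) := rfl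

/-- A map to `U ⊗ P(r)` is determined by its component in the socle. -/
theorem hom_env_apply {r : ZMod 2} (f : T →ₗ[D4 k] env k U r) (x : T) :
    moduleOfId (relations_env k U r) (f x) =
      (-(moduleOfId (relations_env k U r) (f (of k .d • of k .a • x))).2.2.2,
        -(moduleOfId (relations_env k U r) (f (of k .d • x))).2.2.2,
        (moduleOfId (relations_env k U r) (f (of k .a • x))).2.2.2,
        (moduleOfId (relations_env k U r) (f x)).2.2.2) := by
  simp [moduleOfId_of_smul, action]

/-- `env k U r` is coinduced from the subalgebra generated by b and c, which is semisimple when 2 is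
invertible. Extending a map into it thus means extending its socle component compatibly with b and
c: extend it linearly, then average. -/
theorem injective_env (h2 : (2 : k) ≠ 0) (U : Type u) [AddCommGroup U] [Module k U] (r : ZMod 2) :
    Module.Injective (D4 k) (env k U r) where
  out X Y _ _ _ _ f hf g := by
    let _ : Module k X := Module.compHom X (algebraMap k (D4 k))
    let _ : Module k Y := Module.compHom Y (algebraMap k (D4 k))
    have hX : ∀ (c : k) (x : X), c • x = algebraMap k (D4 k) c • x := fun _ _ => rfl
    have hY : ∀ (c : k) (x : Y), c • x = algebraMap k (D4 k) c • x := fun _ _ => rfl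
    let f' : X →ₗ[k] Y := { f with map_smul' := fun c x => f.map_smul (algebraMap k (D4 k) c) x }
    obtain ⟨l, hl⟩ := f'.exists_leftInverse_of_injective (LinearMap.ker_eq_bot.2 hf)
    have hl' : ∀ x, l (f x) = x := fun x => LinearMap.congr_fun hl x
    let φ : Y →+ U :=
      { toFun := fun y => (moduleOfId (relations_env k U r) (g (l y))).2.2.2
        map_zero' := by simp
        map_add' := by simp }
    have hφ : ∀ y, φ y = (moduleOfId (relations_env k U r) (g (l y))).2.2.2 := fun _ => rfl
    have hφs : ∀ (c : k) y, φ (algebraMap k (D4 k) c • y) = c • φ y := fun c y => by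
      rw [hφ, hφ, ← hY, l.map_smul, hX, g.map_smul, moduleOfId_algebraMap_smul]
      rfl
    -- The average of φ over 1, b, c, bc, twisted by the character (-1)^r of both b and c; the twist
    -- is trivial on bc.
    let ψ : Y →+ U :=
      { toFun := fun y => (4 : k)⁻¹ • (φ y + sgn k r • φ (of k .b • y) + sgn k r • φ (of k .c • y)
          + φ (of k .b • of k .c • y))
        map_zero' := by simp
        map_add' := fun x y => by
          rw [← smul_add]
          congr 1
          simp only [smul_add, map_add]
          abel }
    have hψ : ∀ y, ψ y = (4 : k)⁻¹ • (φ y + sgn k r • φ (of k .b • y) + sgn k r • φ (of k .c • y)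
          + φ (of k .b • of k .c • y)) := fun _ => rfl
    obtain ⟨ba, db, ca, dc, bc, aa, bb, cc, dd, da⟩ := relations_of k
    have hbb : ∀ z : Y, of k .b • of k .b • z = z := fun z => by
      rw [← mul_smul, ← pow_two, bb, one_smul]
    have hcc : ∀ z : Y, of k .c • of k .c • z = z := fun z => by
      rw [← mul_smul, ← pow_two, cc, one_smul]
    have hbc : ∀ z : Y, of k .c • of k .b • z = of k .b • of k .c • z := fun z => by
      rw [← mul_smul, ← mul_smul, bc]
    have hss : ∀ u : U, sgn k r • sgn k r • u = u := fun u => by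
      rw [smul_smul, sgn_mul_self, one_smul]
    have h4 : (4 : k) ≠ 0 := by
      rw [show (4 : k) = 2 * 2 by norm_num]
      exact mul_ne_zero h2 h2
    let F : Y →ₗ[D4 k] env k U r := homEnv r ψ
      (fun c y => by
        simp only [hψ, smul_algebraMap_comm, hφs, smul_add, fun (x : k) (u : U) => smul_comm x c u])
      (fun y => by
        simp only [hψ, hbb, hbc, smul_add, smul_comm (sgn k r) (4 : k)⁻¹, hss]
        abel)
      (fun y => by
        simp only [hψ, hcc, smul_add, smul_comm (sgn k r) (4 : k)⁻¹, hss]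
        abel)
    have hψf : ∀ x, ψ (f x) = (moduleOfId (relations_env k U r) (g x)).2.2.2 := fun x => by
      simp only [hψ, hφ, ← map_smul f, hl']
      simp only [map_smul g, moduleOfId_of_smul, action, envB_apply, hss]
      generalize (moduleOfId (relations_env k U r) (g x)).2.2.2 = u
      rw [show u + u + u + u = (4 : k) • u by module, inv_smul_smul₀ h4]
    refine ⟨F, fun x => (moduleOfId (relations_env k U r)).injective ?_⟩
    rw [hom_env_apply g, moduleOfId_homEnv]
    simp only [← map_smul f, hψf]

end Envelope

/-! ### Injective envelopes and cosyzygies of pencils -/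

section Cosyzygy

variable {E F F' : Type u} [AddCommGroup E] [Module k E] [AddCommGroup F] [Module k F]
  [AddCommGroup F'] [Module k F']

/-- The embedding of the module of a pair of linear maps into copies of `P(r)`. -/
def pencilToEnvAux (α δ : E →ₗ[k] F) : E × F →ₗ[k] F × F × F × F where
  toFun x := (0, -δ x.1, α x.1, x.2)
  map_add' x y := by simp [add_comm]
  map_smul' c x := by simp

@[simp] theorem pencilToEnvAux_apply (α δ : E →ₗ[k] F) (x : E × F) :
    pencilToEnvAux α δ x = (0, -δ x.1, α x.1, x.2) := rfl

/-- The map from copies of `P(r)` to the module of a pair of linear maps. -/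
def envToPencilAux (α δ : F →ₗ[k] F') : F × F × F × F →ₗ[k] F × F' where
  toFun x := (x.1, α x.2.1 + δ x.2.2.1)
  map_add' x y := by simp [add_add_add_comm]
  map_smul' c x := by simp

@[simp] theorem envToPencilAux_apply (α δ : F →ₗ[k] F') (x : F × F × F × F) :
    envToPencilAux α δ x = (x.1, α x.2.1 + δ x.2.2.1) := rfl

/-- The injective envelope of the module of a pair of linear maps. -/
def pencilToEnv (α δ : E →ₗ[k] F) (r : ZMod 2) : pencil α δ r →ₗ[D4 k] env k F r :=
  moduleOfHom _ _ (pencilToEnvAux α δ) (by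
    intro g x
    cases g <;> simp [action])

/-- The projection of copies of `P(r)` to the cokernel of an injective envelope. -/
def envToPencil (α δ : F →ₗ[k] F') (r : ZMod 2) : env k F r →ₗ[D4 k] pencil α δ (r + 1) :=
  moduleOfHom _ _ (envToPencilAux α δ) (by
    intro g x
    cases g <;> simp [action, sgn_add_one])

/-- The image contains the last coordinate of `env k F r`, its socle, and every nonzero element can
be moved to a nonzero socle element by one of da, d, a, 1. -/
theorem isInjectiveEnvelope_pencilToEnv (h2 : (2 : k) ≠ 0) (α δ : E →ₗ[k] F)
    (hinj : ∀ e, α e = 0 → δ e = 0 → e = 0) (r : ZMod 2) :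
    IsInjectiveEnvelope (pencilToEnv α δ r) where
  injective := injective_env h2 F r
  mono := by
    rw [← LinearMap.ker_eq_bot, Submodule.eq_bot_iff]
    intro x hx
    have h1 : pencilToEnvAux α δ (moduleOfId _ x) = 0 := hx
    simp only [pencilToEnvAux_apply, Prod.mk_eq_zero, neg_eq_zero] at h1
    exact (moduleOfId (relations_pencil α δ r)).injective
      (Prod.ext (hinj _ h1.2.2.1 h1.2.1) h1.2.2.2)
  essential S hS := by
    have key : ∀ x ∈ S, ∀ y, moduleOfId (relations_env k F r) x = (0, 0, 0, y) → x = 0 := by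
      intro x hx y hy
      have : x ∈ S ⊓ LinearMap.range (pencilToEnv α δ r) :=
        ⟨hx, (moduleOfId (relations_pencil α δ r)).symm (0, y),
          (moduleOfId (relations_env k F r)).injective (by
            rw [hy, pencilToEnv, moduleOfId_moduleOfHom]; simp)⟩
      rw [hS] at this
      simpa using this
    rw [Submodule.eq_bot_iff]
    intro x hx
    obtain ⟨x1, x2, x3, x4, hx'⟩ : ∃ x1 x2 x3 x4,
        moduleOfId (relations_env k F r) x = (x1, x2, x3, x4) := ⟨_, _, _, _, rfl⟩
    -- da sends (x1, x2, x3, x4) to the socle element -x1. Once x1 = 0, d and a give -x2 and x3.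
    have e1 := congrArg (moduleOfId (relations_env k F r))
      (key _ (S.smul_mem (of k .d) (S.smul_mem (of k .a) hx)) (-x1) (by
        simp [moduleOfId_of_smul, action, hx']))
    simp [moduleOfId_of_smul, action, hx'] at e1
    subst e1
    have e2 := congrArg (moduleOfId (relations_env k F r))
      (key _ (S.smul_mem (of k .d) hx) (-x2) (by
        simp [moduleOfId_of_smul, action, hx']))
    simp [moduleOfId_of_smul, action, hx'] at e2
    subst e2
    have e3 := congrArg (moduleOfId (relations_env k F r))
      (key _ (S.smul_mem (of k .a) hx) x3 (by
        simp [moduleOfId_of_smul, action, hx']))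
    simp [moduleOfId_of_smul, action, hx'] at e3
    subst e3
    exact key x hx x4 hx'

/-- The cosyzygies of the module of a pair of linear maps. -/
theorem isCosyzygy_pencil_succ (h2 : (2 : k) ≠ 0) {s : ℕ} {M : ModuleCat.{u} (D4 k)}
    {α δ : E →ₗ[k] F} {α' δ' : F →ₗ[k] F'} {r : ZMod 2} (h : IsCosyzygy s M (pencil α δ r))
    (hinj : ∀ e, α e = 0 → δ e = 0 → e = 0) (hcomm : ∀ e, α' (δ e) = δ' (α e))
    (hex : ∀ f g, α' f + δ' g = 0 → ∃ e, f = -δ e ∧ g = α e)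
    (hsurj : ∀ f', ∃ f g, α' f + δ' g = f') :
    IsCosyzygy (s + 1) M (pencil α' δ' (r + 1)) := by
  refine ⟨_, _, pencilToEnv α δ r, h, isInjectiveEnvelope_pencilToEnv h2 α δ hinj r, ?_⟩
  have hker : LinearMap.ker (envToPencil α' δ' r) = LinearMap.range (pencilToEnv α δ r) := by
    ext x
    constructor
    · intro hx
      have hx' : envToPencilAux α' δ' (moduleOfId _ x) = 0 := hx
      simp only [envToPencilAux_apply, Prod.mk_eq_zero] at hx'
      obtain ⟨e, he, he'⟩ := hex _ _ hx'.2
      refine ⟨(moduleOfId (relations_pencil α δ r)).symm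
        (e, (moduleOfId (relations_env k F r) x).2.2.2),
          (moduleOfId (relations_env k F r)).injective ?_⟩
      rw [pencilToEnv, moduleOfId_moduleOfHom]
      simp [← he, ← he', ← hx'.1]
    · rintro ⟨y, rfl⟩
      refine (moduleOfId (relations_pencil α' δ' (r + 1))).injective ?_
      rw [envToPencil, moduleOfId_moduleOfHom, pencilToEnv, moduleOfId_moduleOfHom]
      simp [hcomm]
  have hs : Function.Surjective (envToPencil α' δ' r) := by
    intro y
    obtain ⟨f, g, hfg⟩ := hsurj (moduleOfId (relations_pencil α' δ' (r + 1)) y).2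
    refine ⟨(moduleOfId (relations_env k F r)).symm
      ((moduleOfId (relations_pencil α' δ' (r + 1)) y).1, f, g, 0),
      (moduleOfId (relations_pencil α' δ' (r + 1))).injective ?_⟩
    rw [envToPencil, moduleOfId_moduleOfHom]
    simp [hfg]
  exact ⟨(Submodule.quotEquivOfEq _ _ hker.symm).trans (LinearMap.quotKerEquivOfSurjective _ hs)⟩

end Cosyzygy

/-! ### The decomposition of a tensor product of pencils -/

section Tensor

variable {k : Type u} [Field k]

theorem sgn_add (r r' : ZMod 2) : sgn k (r + r') = sgn k r * sgn k r' := by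
  have h : ∀ r : ZMod 2, r = 0 ∨ r = 0 + 1 := by decide
  obtain rfl | rfl := h r'
  · simp [sgn]
  · rw [← add_assoc, add_zero, sgn_add_one, sgn_add_one]
    simp [sgn]

variable {X E F : Type u} [AddCommGroup X] [Module k X] [AddCommGroup E] [Module k E]
  [AddCommGroup F] [Module k F]

open _root_.TensorProduct in
/-- An element of `(X × X) ⊗ (E × F)` vanishes if its four components do. -/
theorem tensor_prod_eq_zero {z : (X × X) ⊗[k] (E × F)}
    (h11 : map (LinearMap.fst k X X) (LinearMap.fst k E F) z = 0)
    (h12 : map (LinearMap.fst k X X) (LinearMap.snd k E F) z = 0)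
    (h21 : map (LinearMap.snd k X X) (LinearMap.fst k E F) z = 0)
    (h22 : map (LinearMap.snd k X X) (LinearMap.snd k E F) z = 0) : z = 0 := by
  have key : z =
      map (LinearMap.inl k X X) (LinearMap.inl k E F)
        (map (LinearMap.fst k X X) (LinearMap.fst k E F) z) +
      map (LinearMap.inl k X X) (LinearMap.inr k E F)
        (map (LinearMap.fst k X X) (LinearMap.snd k E F) z) +
      map (LinearMap.inr k X X) (LinearMap.inl k E F)
        (map (LinearMap.snd k X X) (LinearMap.fst k E F) z) +
      map (LinearMap.inr k X X) (LinearMap.inr k E F)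
        (map (LinearMap.snd k X X) (LinearMap.snd k E F) z) := by
    clear h11 h12 h21 h22
    induction z with
    | zero => simp
    | add z z' h h' =>
      conv_lhs => rw [h, h']
      simp only [map_add]
      abel
    | tmul m n =>
      obtain ⟨x, y⟩ := m
      obtain ⟨e, f⟩ := n
      simp [← tmul_add, ← add_tmul, add_assoc]
  rw [key, h11, h12, h21, h22]
  simp

open _root_.TensorProduct in
/-- The tensor product of the modules given by two pairs of linear maps `A, D : X → X` and
`α, δ : E → F`, provided that `α` and `δ` are compatible with `A` and `D` under an evaluation of
the elements of `E` and `F` at endomorphisms of `X`, and `F` has one dimension more than `E`. -/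
theorem tensor_pencil_equiv [FiniteDimensional k X] [FiniteDimensional k E]
    [FiniteDimensional k F] (hfin : Module.finrank k F = Module.finrank k E + 1)
    (A D : Module.End k X) (α δ : E →ₗ[k] F) (evE : E →ₗ[k] Module.End k X)
    (evF : F →ₗ[k] Module.End k X) (φ : F →ₗ[k] E) (hAD : A = 1 ∨ D = 1)
    (hAE : ∀ e, Commute A (evE e)) (hDE : ∀ e, Commute D (evE e))
    (hAF : ∀ f, Commute A (evF f)) (hDF : ∀ f, Commute D (evF f))
    (hα : ∀ e, evF (α e) = A * evE e) (hδ : ∀ e, evF (δ e) = D * evE e)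
    (hinj : ∀ z : X ⊗[k] E, map (.id : X →ₗ[k] X) φ (map A δ z) = map .id φ (map D α z) → z = 0)
    (hφ : ∀ z : X ⊗[k] F, map (.id : X →ₗ[k] X) φ z = 0 → _root_.TensorProduct.lift evF.flip z = 0 → z = 0)
    (r r' : ZMod 2) :
    Nonempty (moduleOf (relations_tensor (relations_pencil A D r) (relations_pencil α δ r'))
      ≃ₗ[D4 k] env k (X ⊗[k] E) (r + r') × pencil A D (r + r')) := by
  let p11 := map (LinearMap.fst k X X) (LinearMap.fst k E F)
  let p12 := map (LinearMap.fst k X X) (LinearMap.snd k E F)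
  let p21 := map (LinearMap.snd k X X) (LinearMap.fst k E F)
  let p22 := map (LinearMap.snd k X X) (LinearMap.snd k E F)
  let Ta : Module.End k ((X × X) ⊗[k] (E × F)) :=
    map (lowerMap A) (gradingMap k E F r') + map 1 (lowerMap α)
  let Td : Module.End k ((X × X) ⊗[k] (E × F)) :=
    map (lowerMap D) (gradingMap k E F r') + map 1 (lowerMap δ)
  let Tb : Module.End k ((X × X) ⊗[k] (E × F)) :=
    map (gradingMap k X X r) (gradingMap k E F r')
  have rel : Relations Ta Tb Tb Td :=
    relations_tensor (relations_pencil A D r) (relations_pencil α δ r')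
  set σ := sgn k r'
  -- the action in terms of the components
  have p11a : ∀ z, p11 (Ta z) = 0 := fun z => by
    induction z with
    | zero => simp
    | add z z' h h' => rw [map_add, map_add, h, h', add_zero]
    | tmul m n => simp [p11, Ta]
  have p12a : ∀ z, p12 (Ta z) = map .id α (p11 z) := fun z => by
    induction z with
    | zero => simp
    | add z z' h h' => simp only [map_add] at *; rw [h, h']
    | tmul m n => simp [p12, p11, Ta]
  have p21a : ∀ z, p21 (Ta z) = -σ • map A .id (p11 z) := fun z => by
    induction z with
    | zero => simp
    | add z z' h h' => simp only [map_add, smul_add] at *; rw [h, h']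
    | tmul m n => simp [p21, p11, Ta, sgn_add_one, σ, tmul_neg]
  have p22a : ∀ z, p22 (Ta z) = σ • map A .id (p12 z) + map .id α (p21 z) := fun z => by
    induction z with
    | zero => simp
    | add z z' h h' => simp only [map_add, smul_add] at *; rw [h, h']; abel
    | tmul m n => simp [p21, p12, p22, Ta, σ]
  have p11d : ∀ z, p11 (Td z) = 0 := fun z => by
    induction z with
    | zero => simp
    | add z z' h h' => rw [map_add, map_add, h, h', add_zero]
    | tmul m n => simp [p11, Td]
  have p12d : ∀ z, p12 (Td z) = map .id δ (p11 z) := fun z => by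
    induction z with
    | zero => simp
    | add z z' h h' => simp only [map_add] at *; rw [h, h']
    | tmul m n => simp [p12, p11, Td]
  have p21d : ∀ z, p21 (Td z) = -σ • map D .id (p11 z) := fun z => by
    induction z with
    | zero => simp
    | add z z' h h' => simp only [map_add, smul_add] at *; rw [h, h']
    | tmul m n => simp [p21, p11, Td, sgn_add_one, σ, tmul_neg]
  have p22d : ∀ z, p22 (Td z) = σ • map D .id (p12 z) + map .id δ (p21 z) := fun z => by
    induction z with
    | zero => simp
    | add z z' h h' => simp only [map_add, smul_add] at *; rw [h, h']; abel
    | tmul m n => simp [p21, p12, p22, Td, σ]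
  have p12b : ∀ z, p12 (Tb z) = sgn k (r + r' + 1) • p12 z := fun z => by
    induction z with
    | zero => simp
    | add z z' h h' => simp only [map_add, smul_add] at *; rw [h, h']
    | tmul m n => simp [p12, Tb, sgn_add, ← smul_tmul', smul_smul, mul_left_comm,
      mul_assoc]
  have p21b : ∀ z, p21 (Tb z) = sgn k (r + r' + 1) • p21 z := fun z => by
    induction z with
    | zero => simp
    | add z z' h h' => simp only [map_add, smul_add] at *; rw [h, h']
    | tmul m n => simp [p21, Tb, sgn_add, ← smul_tmul', smul_smul, mul_comm,
      mul_assoc]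
  have p22b : ∀ z, p22 (Tb z) = sgn k (r + r') • p22 z := fun z => by
    induction z with
    | zero => simp
    | add z z' h h' => simp only [map_add, smul_add] at *; rw [h, h']
    | tmul m n => simp [p22, Tb, sgn_add, ← smul_tmul', smul_smul, mul_comm]
  -- properties of the evaluation
  let vE : X ⊗[k] E →ₗ[k] X := _root_.TensorProduct.lift evE.flip
  let vF : X ⊗[k] F →ₗ[k] X := _root_.TensorProduct.lift evF.flip
  have vE_comm : ∀ B : Module.End k X, (∀ e, Commute B (evE e)) →
      ∀ z, vE (map B .id z) = B (vE z) := fun B hB z => by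
    induction z with
    | zero => simp
    | add z z' h h' => simp only [map_add, h, h']
    | tmul x e => simpa [vE] using (LinearMap.congr_fun (hB e).eq x).symm
  have vF_comm : ∀ B : Module.End k X, (∀ f, Commute B (evF f)) →
      ∀ z, vF (map B .id z) = B (vF z) := fun B hB z => by
    induction z with
    | zero => simp
    | add z z' h h' => simp only [map_add, h, h']
    | tmul x e => simpa [vF] using (LinearMap.congr_fun (hB e).eq x).symm
  have vF_map : ∀ (β : E →ₗ[k] F) (B : Module.End k X), (∀ e, evF (β e) = B * evE e) →
      ∀ z, vF (map .id β z) = B (vE z) := fun β B hB z => by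
    induction z with
    | zero => simp
    | add z z' h h' => simp only [map_add, h, h']
    | tmul x e => simp [vF, vE, hB]
  -- the projection to the socle of the projective summand
  let Φ : (X × X) ⊗[k] (E × F) →ₗ[k] X ⊗[k] E := map .id φ ∘ₗ p22
  have hΦb : ∀ z, Φ (Tb z) = sgn k (r + r') • Φ z := fun z => by simp [Φ, p22b]
  -- the projection to the other summand
  let Ψ : (X × X) ⊗[k] (E × F) →ₗ[k] X × X :=
    (vE ∘ₗ p21 + σ • vF ∘ₗ p12).prod (vF ∘ₗ p22)
  have hΨ1 : ∀ z, (Ψ z).1 = vE (p21 z) + σ • vF (p12 z) := fun _ => rfl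
  have hΨ2 : ∀ z, (Ψ z).2 = vF (p22 z) := fun _ => rfl
  -- The factor σ in the first component of Ψ balances the signs of b and c in the coproducts of a
  -- and d: it makes the two terms coming from p11 cancel.
  have hΨ : ∀ g z, Ψ (action Ta Tb Tb Td g z) = action (lowerMap A) (gradingMap k X X (r + r'))
      (gradingMap k X X (r + r')) (lowerMap D) g (Ψ z) := by
    have hb : ∀ z, Ψ (Tb z) = gradingMap k X X (r + r') (Ψ z) := fun z => by
      refine Prod.ext ?_ ?_
      · simp only [hΨ1, p21b, p12b, gradingMap_apply, map_smul, smul_add, smul_comm σ]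
      · simp only [hΨ2, p22b, gradingMap_apply, map_smul]
    intro g z
    cases g
    · refine Prod.ext ?_ ?_
      · simp [action, hΨ1, p21a, p12a, vE_comm A hAE, vF_map α A hα]
      · simp [action, hΨ2, hΨ1, p22a, vF_comm A hAF, vF_map α A hα, add_comm]
    · exact hb z
    · exact hb z
    · refine Prod.ext ?_ ?_
      · simp [action, hΨ1, p21d, p12d, vE_comm D hDE, vF_map δ D hδ]
      · simp [action, hΨ2, hΨ1, p22d, vF_comm D hDF, vF_map δ D hδ, add_comm]
  let G₁ : moduleOf rel →ₗ[D4 k] env k (X ⊗[k] E) (r + r') :=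
    homEnv (r + r') (Φ.toAddMonoidHom.comp (moduleOfId rel).toAddMonoidHom)
      (fun c x => by simp [moduleOfId_algebraMap_smul])
      (fun x => by simp [moduleOfId_of_smul, action, hΦb])
      (fun x => by simp [moduleOfId_of_smul, action, hΦb])
  let G₂ : moduleOf rel →ₗ[D4 k] pencil A D (r + r') := moduleOfHom _ _ Ψ hΨ
  -- The pair G₁, G₂ as a k-linear map, so that dimensions can be compared.
  let Θ : (X × X) ⊗[k] (E × F) →ₗ[k]
      ((X ⊗[k] E) × (X ⊗[k] E) × (X ⊗[k] E) × (X ⊗[k] E)) × (X × X) :=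
    ((-(Φ ∘ₗ Td ∘ₗ Ta)).prod ((-(Φ ∘ₗ Td)).prod ((Φ ∘ₗ Ta).prod Φ))).prod Ψ
  have hG : ∀ x, (moduleOfId (relations_env k (X ⊗[k] E) (r + r')) (G₁ x),
      moduleOfId (relations_pencil A D (r + r')) (G₂ x)) = Θ (moduleOfId rel x) := fun x => by
    simp [G₁, G₂, Θ, moduleOfId_of_smul, action]
  have hσ : σ ≠ 0 := fun h => by simpa [σ, h] using sgn_mul_self k r'
  have map_id_map : ∀ (B : Module.End k X) (β : E →ₗ[k] F) (z : X ⊗[k] E),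
      map B .id (map .id β z) = map B β z := fun B β z => by
    rw [← LinearMap.comp_apply, ← map_comp]; rfl
  have map_map_id : ∀ (B : Module.End k X) (β : E →ₗ[k] F) (z : X ⊗[k] E),
      map .id β (map B .id z) = map B β z := fun B β z => by
    rw [← LinearMap.comp_apply, ← map_comp]; rfl
  have hΘ : Function.Injective Θ := by
    rw [← LinearMap.ker_eq_bot, LinearMap.ker_eq_bot']
    intro z hz
    rw [show Θ z = ((-Φ (Td (Ta z)), -Φ (Td z), Φ (Ta z), Φ z), Ψ z) from rfl] at hz
    simp only [Prod.mk_eq_zero, neg_eq_zero] at hz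
    obtain ⟨⟨hda, hd, ha, h0⟩, hψ⟩ := hz
    have h22 : p22 z = 0 := hφ _ h0 (by rw [← show (Ψ z).2 = _ from hΨ2 z, hψ]; rfl)
    -- Up to the factor σ, the p22-component of d a z is (D ⊗ α - A ⊗ δ) applied to p11 z.
    have h11 : p11 z = 0 := by
      apply hinj
      change map .id φ (p22 (Td (Ta z))) = 0 at hda
      rw [p22d, p12a, p21a, map_smul, map_id_map, map_map_id, neg_smul, ← sub_eq_add_neg,
        ← smul_sub, map_smul, smul_eq_zero_iff_right hσ, map_sub, sub_eq_zero] at hda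
      exact hda.symm
    have ha' : p22 (Ta z) = 0 := hφ _ ha (by
      rw [← show (Ψ (Ta z)).2 = _ from hΨ2 _, show Ψ (Ta z) = lowerMap A (Ψ z) from hΨ .a z, hψ]
      simp)
    have hd' : p22 (Td z) = 0 := hφ _ hd (by
      rw [← show (Ψ (Td z)).2 = _ from hΨ2 _, show Ψ (Td z) = lowerMap D (Ψ z) from hΨ .d z, hψ]
      simp)
    rw [p22a] at ha'
    rw [p22d] at hd'
    have hcomm : ∀ w : X ⊗[k] F, map D .id (map A .id w) = map A .id (map D .id w) := fun w => by
      rw [← LinearMap.comp_apply, ← LinearMap.comp_apply, ← map_comp, ← map_comp]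
      congr 2
      obtain rfl | rfl := hAD <;> rfl
    -- Apply D to the equation from a and A to the one from d: the terms in p12 z agree and drop
    -- out, leaving the hypothesis of `hinj`.
    have h21 : p21 z = 0 := by
      apply hinj
      have e1 := congrArg (map D (.id : F →ₗ[k] F)) ha'
      have e2 := congrArg (map A (.id : F →ₗ[k] F)) hd'
      rw [map_add, map_smul, map_zero, map_id_map] at e1 e2
      rw [← hcomm] at e2
      rw [add_left_cancel (e1.trans e2.symm)]
    rw [h21, map_zero, add_zero, smul_eq_zero_iff_right hσ] at ha' hd'
    refine tensor_prod_eq_zero h11 ?_ h21 h22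
    -- What remains is that A and D both kill p12 z, and one of them is the identity.
    obtain rfl | rfl := hAD
    · simpa [Module.End.one_eq_id] using ha'
    · simpa [Module.End.one_eq_id] using hd'
  -- This is where dim F = dim E + 1 enters.
  have hdim : Module.finrank k ((X × X) ⊗[k] (E × F)) = Module.finrank k
      (((X ⊗[k] E) × (X ⊗[k] E) × (X ⊗[k] E) × (X ⊗[k] E)) × (X × X)) := by
    simp only [Module.finrank_tensorProduct, Module.finrank_prod, hfin]
    ring
  have hΘ' := (LinearMap.injective_iff_surjective_of_finrank_eq_finrank hdim).1 hΘ
  refine ⟨LinearEquiv.ofBijective (G₁.prod G₂) ⟨fun x y hxy => ?_, fun y => ?_⟩⟩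
  · apply (moduleOfId rel).injective
    apply hΘ
    rw [← hG, ← hG, show G₁ x = G₁ y from congrArg Prod.fst hxy,
      show G₂ x = G₂ y from congrArg Prod.snd hxy]
  · obtain ⟨x, hx⟩ := hΘ' (moduleOfId (relations_env k (X ⊗[k] E) (r + r')) y.1,
      moduleOfId (relations_pencil A D (r + r')) y.2)
    refine ⟨(moduleOfId rel).symm x, ?_⟩
    have h := hG ((moduleOfId rel).symm x)
    rw [AddEquiv.apply_symm_apply, hx] at h
    exact Prod.ext ((moduleOfId _).injective (congrArg Prod.fst h))
      ((moduleOfId _).injective (congrArg Prod.snd h))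

end Tensor

/-! ### The cosyzygies of V(r) as spaces of polynomials -/

section Model

variable (k : Type u) [Field k]

/-- Append a zero to a vector. -/
def snocZero (s : ℕ) : (Fin s → k) →ₗ[k] (Fin (s + 1) → k) where
  toFun e := Fin.snoc (α := fun _ => k) e 0
  map_add' e e' := by
    ext i
    induction i using Fin.lastCases <;> simp
  map_smul' c e := by
    ext i
    induction i using Fin.lastCases <;> simp

/-- Prepend a zero to a vector. -/
def consZero (s : ℕ) : (Fin s → k) →ₗ[k] (Fin (s + 1) → k) where
  toFun e := Fin.cons (α := fun _ => k) 0 e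
  map_add' e e' := by
    ext i
    induction i using Fin.cases <;> simp
  map_smul' c e := by
    ext i
    induction i using Fin.cases <;> simp

variable {k} {s : ℕ}

@[simp] theorem snocZero_castSucc (e : Fin s → k) (i : Fin s) :
    snocZero k s e i.castSucc = e i := Fin.snoc_castSucc (α := fun _ => k) 0 e i

@[simp] theorem snocZero_last (e : Fin s → k) : snocZero k s e (Fin.last s) = 0 :=
  Fin.snoc_last (α := fun _ => k) 0 e

@[simp] theorem consZero_zero (e : Fin s → k) : consZero k s e 0 = 0 := rfl

@[simp] theorem consZero_succ (e : Fin s → k) (i : Fin s) : consZero k s e i.succ = e i := rfl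

theorem snocZero_injective {e : Fin s → k} (h : snocZero k s e = 0) : e = 0 := by
  ext i
  simpa using congrFun h i.castSucc

theorem consZero_injective {e : Fin s → k} (h : consZero k s e = 0) : e = 0 := by
  ext i
  simpa using congrFun h i.succ

theorem snocZero_consZero (e : Fin s → k) :
    snocZero k (s + 1) (consZero k s e) = consZero k (s + 1) (snocZero k s e) :=
  (Fin.cons_snoc_eq_snoc_cons (β := k) 0 e 0).symm

/-- With vectors read as coefficient lists, f + xg = 0 forces the top coefficient of g to vanish and
f = -xg. -/
theorem exists_of_snocZero_add_consZero {f g : Fin (s + 1) → k}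
    (h : snocZero k (s + 1) f + consZero k (s + 1) g = 0) :
    ∃ e, f = -consZero k s e ∧ g = snocZero k s e := by
  refine ⟨Fin.init g, ?_, ?_⟩
  · ext i
    induction i using Fin.cases with
    | zero =>
      have := congrFun h 0
      rw [← Fin.castSucc_zero, Pi.add_apply, snocZero_castSucc] at this
      simpa using this
    | succ i =>
      have := congrFun h i.castSucc.succ
      rw [Pi.add_apply, consZero_succ, Fin.succ_castSucc, snocZero_castSucc] at this
      simpa [Fin.init] using eq_neg_of_add_eq_zero_left this
  · ext i
    induction i using Fin.lastCases with
    | last =>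
      have := congrFun h (Fin.last _)
      rw [← Fin.succ_last, Pi.add_apply, consZero_succ, Fin.succ_last, snocZero_last] at this
      simpa using this
    | cast i => simp [Fin.init]

theorem exists_snocZero_add_consZero (f : Fin (s + 2) → k) :
    ∃ g h, snocZero k (s + 1) g + consZero k (s + 1) h = f := by
  -- Split a polynomial as f(0) + x · (f - f(0))/x.
  refine ⟨Pi.single 0 (f 0), Fin.tail f, ?_⟩
  ext i
  induction i using Fin.cases with
  | zero =>
    have h := snocZero_castSucc (k := k) (Pi.single 0 (f 0) : Fin (s + 1) → k) 0
    rw [Fin.castSucc_zero] at h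
    simp [h]
  | succ i =>
    rw [Pi.add_apply, consZero_succ]
    induction i using Fin.lastCases with
    | last => rw [Fin.succ_last, snocZero_last]; simp [Fin.tail]
    | cast i => rw [Fin.succ_castSucc, snocZero_castSucc]; simp [Fin.tail]

/-- The simple module `V(r)` as a pair of linear maps. -/
theorem V_equiv_pencil (α δ : (Fin 0 → k) →ₗ[k] (Fin 1 → k)) (r : ZMod 2) :
    Nonempty (V k r ≃ₗ[D4 k] pencil α δ r) := by
  let f : k →ₗ[k] (Fin 0 → k) × (Fin 1 → k) :=
    (0 : k →ₗ[k] (Fin 0 → k)).prod (LinearMap.pi fun _ => LinearMap.id)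
  have h0 : ∀ (β : (Fin 0 → k) →ₗ[k] (Fin 1 → k)) v, β v = 0 := fun β v => by
    rw [Subsingleton.elim v 0, map_zero]
  refine ⟨moduleOfEquiv (relations_V k r) (relations_pencil α δ r) f ?_ ⟨?_, ?_⟩⟩
  · intro g x
    cases g
    · refine Prod.ext (Subsingleton.elim _ _) ?_
      simp [action, h0]
    · refine Prod.ext (Subsingleton.elim _ _) ?_
      ext i
      simp [action, f]
    · refine Prod.ext (Subsingleton.elim _ _) ?_
      ext i
      simp [action, f]
    · refine Prod.ext (Subsingleton.elim _ _) ?_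
      simp [action, h0]
  · intro x y h
    exact congrFun (congrArg Prod.snd h) 0
  · intro y
    refine ⟨y.2 0, Prod.ext (Subsingleton.elim _ _) ?_⟩
    ext i
    rw [Subsingleton.elim i 0]
    rfl

theorem isCosyzygy_snocZero_consZero (h2 : (2 : k) ≠ 0) (s : ℕ) (r : ZMod 2) :
    IsCosyzygy s (V k r) (pencil (snocZero k s) (consZero k s) (r + s)) := by
  induction s with
  | zero =>
    rw [Nat.cast_zero, add_zero]
    exact V_equiv_pencil _ _ r
  | succ s ih =>
    rw [Nat.cast_succ, ← add_assoc]
    exact isCosyzygy_pencil_succ h2 ih (fun e he _ => snocZero_injective he)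
      snocZero_consZero (fun f g h => exists_of_snocZero_add_consZero h)
      exists_snocZero_add_consZero

/-- The same cosyzygy with the roles of a and d exchanged; this form is the one suited to η = ∞,
where d rather than a acts as the identity. -/
theorem isCosyzygy_consZero_snocZero (h2 : (2 : k) ≠ 0) (s : ℕ) (r : ZMod 2) :
    IsCosyzygy s (V k r) (pencil (consZero k s) (snocZero k s) (r + s)) := by
  induction s with
  | zero =>
    rw [Nat.cast_zero, add_zero]
    exact V_equiv_pencil _ _ r
  | succ s ih =>
    rw [Nat.cast_succ, ← add_assoc]
    refine isCosyzygy_pencil_succ h2 ih (fun e he _ => consZero_injective he)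
      (fun e => (snocZero_consZero e).symm) (fun f g h => ?_) (fun f => ?_)
    · obtain ⟨e, he, he'⟩ := exists_of_snocZero_add_consZero (f := g) (g := f)
        ((add_comm _ _).trans h)
      exact ⟨-e, by simp [he'], by simp [he]⟩
    · obtain ⟨g, h, hgh⟩ := exists_snocZero_add_consZero f
      exact ⟨h, g, (add_comm _ _).trans hgh⟩

end Model

/-! ### Evaluating polynomials at an endomorphism -/

section Evaluation

variable {k : Type u} [Field k] {X : Type u} [AddCommGroup X] [Module k X]

/-- Evaluate the polynomial with coefficients `e` at an endomorphism. -/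
noncomputable def evalAt (T : Module.End k X) (s : ℕ) : (Fin s → k) →ₗ[k] Module.End k X :=
  ∑ i : Fin s, (LinearMap.proj i).smulRight (T ^ (i : ℕ))

theorem evalAt_apply (T : Module.End k X) (s : ℕ) (e : Fin s → k) :
    evalAt T s e = ∑ i : Fin s, e i • T ^ (i : ℕ) := by
  simp [evalAt]

theorem evalAt_snocZero (T : Module.End k X) (s : ℕ) (e : Fin s → k) :
    evalAt T (s + 1) (snocZero k s e) = evalAt T s e := by
  simp [evalAt_apply, Fin.sum_univ_castSucc]

theorem evalAt_consZero (T : Module.End k X) (s : ℕ) (e : Fin s → k) :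
    evalAt T (s + 1) (consZero k s e) = T * evalAt T s e := by
  simp [evalAt_apply, Fin.sum_univ_succ, Finset.mul_sum, pow_succ']

theorem commute_evalAt (T : Module.End k X) (s : ℕ) (e : Fin s → k) :
    Commute T (evalAt T s e) := by
  rw [evalAt_apply]
  exact Commute.sum_right _ _ _ fun i _ => ((Commute.refl T).pow_right _).smul_right _

/-- Delete the first entry of a vector. -/
def tailMap (k : Type u) [Field k] (s : ℕ) : (Fin (s + 1) → k) →ₗ[k] (Fin s → k) :=
  LinearMap.funLeft k k Fin.succ

@[simp] theorem tailMap_apply {s : ℕ} (f : Fin (s + 1) → k) (i : Fin s) :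
    tailMap k s f i = f i.succ := rfl

theorem tailMap_consZero (s : ℕ) : tailMap k s ∘ₗ consZero k s = LinearMap.id := by
  ext; simp

/-- The composite shifts the s coefficients down by one place and fills in a zero at the top. -/
theorem tailMap_snocZero_pow {s : ℕ} : (tailMap k s ∘ₗ snocZero k s) ^ s = 0 := by
  have h1 : ∀ (e : Fin s → k) (i : ℕ) (hi : i < s) (hi' : i + 1 < s),
      (tailMap k s ∘ₗ snocZero k s) e ⟨i, hi⟩ = e ⟨i + 1, hi'⟩ := fun e i hi hi' =>
    snocZero_castSucc e ⟨i + 1, hi'⟩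
  have h2 : ∀ (e : Fin s → k) (i : ℕ) (hi : i < s), ¬ i + 1 < s →
      (tailMap k s ∘ₗ snocZero k s) e ⟨i, hi⟩ = 0 := fun e i hi hi' => by
    have : (⟨i, hi⟩ : Fin s).succ = Fin.last s := Fin.ext (by simp; omega)
    rw [LinearMap.comp_apply, tailMap_apply, this, snocZero_last]
  have h : ∀ (j : ℕ) (e : Fin s → k) (i : ℕ) (hi : i < s), s ≤ i + j →
      ((tailMap k s ∘ₗ snocZero k s) ^ j) e ⟨i, hi⟩ = 0 := by
    intro j
    induction j with
    | zero => intro e i hi h; omega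
    | succ j ih =>
      intro e i hi h
      rw [pow_succ', Module.End.mul_apply]
      by_cases hi' : i + 1 < s
      · rw [h1 _ i hi hi']
        exact ih e (i + 1) hi' (by omega)
      · exact h2 _ i hi hi'
  refine LinearMap.ext fun e => funext fun i => ?_
  exact h s e i i.2 (by omega)

-- The hypothesis says z = (T ⊗ N)z, with N the nilpotent shift of `tailMap_snocZero_pow`; iterating
-- s times gives z = 0.
open _root_.TensorProduct in
theorem eq_zero_of_map_tailMap {s : ℕ} (T : Module.End k X) (z : X ⊗[k] (Fin s → k))
    (h : map (.id : X →ₗ[k] X) (tailMap k s) (map .id (consZero k s) z) =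
      map .id (tailMap k s) (map T (snocZero k s) z)) : z = 0 := by
  have hz : z = map T (tailMap k s ∘ₗ snocZero k s) z := by
    rw [← LinearMap.comp_apply, ← LinearMap.comp_apply, ← map_comp, ← map_comp,
      tailMap_consZero] at h
    simpa using h
  have hpow : ∀ n : ℕ, z = (map T (tailMap k s ∘ₗ snocZero k s) ^ n) z := by
    intro n
    induction n with
    | zero => simp
    | succ n ih => rw [pow_succ, Module.End.mul_apply, ← hz]; exact ih
  rw [hpow s, _root_.TensorProduct.map_pow, tailMap_snocZero_pow]
  simp

-- If (p - p(0))/x vanishes, p is constant and hence equal to its value at T; the argument is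
-- carried out with coefficients in X.
open _root_.TensorProduct in
theorem eq_zero_of_tailMap_of_evalAt {s : ℕ} (T : Module.End k X) (z : X ⊗[k] (Fin (s + 1) → k))
    (h : map (.id : X →ₗ[k] X) (tailMap k s) z = 0)
    (h' : _root_.TensorProduct.lift (evalAt T (s + 1)).flip z = 0) : z = 0 := by
  -- c takes the constant coefficient; `e1` is p = x · (p - p(0))/x + p(0), and `e2` is its
  -- evaluation at T.
  let c : X ⊗[k] (Fin (s + 1) → k) →ₗ[k] X :=
    (TensorProduct.rid k X).toLinearMap ∘ₗ map .id (LinearMap.proj 0)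
  have hc : ∀ x (f : Fin (s + 1) → k), c (x ⊗ₜ f) = f 0 • x := fun x f => by simp [c]
  have e1 : ∀ z, z = map (.id : X →ₗ[k] X) (consZero k s) (map .id (tailMap k s) z) +
      c z ⊗ₜ Pi.single 0 1 := fun z => by
    induction z with
    | zero => simp
    | add z z' h h' =>
      conv_lhs => rw [h, h']
      simp only [map_add, add_tmul]
      abel
    | tmul x f =>
      rw [hc, smul_tmul, map_tmul, map_tmul, LinearMap.id_apply, LinearMap.id_apply, ← tmul_add]
      congr 1
      ext i
      induction i using Fin.cases <;> simp
  have e2 : ∀ z, _root_.TensorProduct.lift (evalAt T (s + 1)).flip z =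
      T (_root_.TensorProduct.lift (evalAt T s).flip (map .id (tailMap k s) z)) + c z := fun z => by
    induction z with
    | zero => simp
    | add z z' h h' =>
      simp only [map_add, h, h']
      abel
    | tmul x f =>
      rw [hc]
      simp [evalAt_apply, Fin.sum_univ_succ, pow_succ', add_comm, map_sum]
  rw [e2, h, map_zero, map_zero, zero_add] at h'
  rw [e1 z, h, h']
  simp

end Evaluation

/-! ### Choosing a basis of U in U ⊗ P(r) -/

section Projective

variable {k : Type u} [Field k]

theorem env_equiv {U : Type u} [AddCommGroup U] [Module k U] [FiniteDimensional k U] {n : ℕ}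
    (hn : Module.finrank k U = n) (r : ZMod 2) :
    Nonempty (env k U r ≃ₗ[D4 k] (Fin n → P k r)) := by
  let b := Module.finBasisOfFinrankEq k U hn
  let rel := relations_map (Matrix.toLinAlgEquiv' (R := k) (n := Fin 4)).toAlgHom.toRingHom
    (relations_P_matrix k r)
  let f (i : Fin n) : U × U × U × U →ₗ[k] (Fin 4 → k) :=
    { toFun := fun x => ![b.coord i x.1, b.coord i x.2.1, b.coord i x.2.2.1, b.coord i x.2.2.2]
      map_add' := fun x y => by simp
      map_smul' := fun c x => by simp }
  have hf : ∀ i x, f i x =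
      ![b.coord i x.1, b.coord i x.2.1, b.coord i x.2.2.1, b.coord i x.2.2.2] := fun _ _ => rfl
  let g (i : Fin n) : env k U r →ₗ[D4 k] moduleOf rel :=
    moduleOfHom (relations_env k U r) rel (f i) (fun g x => by
      rw [hf, hf]
      cases g <;> ext j <;> fin_cases j <;>
        simp [action, Pa, Pb, Pd, Matrix.mulVec_diagonal, Matrix.vecHead, Matrix.vecTail])
  refine ⟨LinearEquiv.ofBijective (LinearMap.pi g : env k U r →ₗ[D4 k] (Fin n → moduleOf rel))
    ⟨fun x y hxy => ?_, fun y => ?_⟩⟩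
  · apply (moduleOfId (relations_env k U r)).injective
    have h : ∀ i j, f i (moduleOfId _ x) j = f i (moduleOfId _ y) j := fun i j =>
      congrFun (congrFun hxy i) j
    exact Prod.ext (b.ext_elem fun i => h i 0) (Prod.ext (b.ext_elem fun i => h i 1)
      (Prod.ext (b.ext_elem fun i => h i 2) (b.ext_elem fun i => h i 3)))
  · let u (j : Fin 4) : U := b.equivFun.symm fun i => moduleOfId rel (y i) j
    have hu : ∀ i j, b.coord i (u j) = moduleOfId rel (y i) j := fun i j => by
      simp [u, ← Module.Basis.equivFun_apply, -Module.Basis.equivFun_symm_apply]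
    refine ⟨(moduleOfId (relations_env k U r)).symm (u 0, u 1, u 2, u 3), ?_⟩
    refine funext fun i => (moduleOfId rel).injective ?_
    change f i (u 0, u 1, u 2, u 3) = _
    rw [hf]
    ext j
    fin_cases j <;> simp only [hu] <;> rfl

end Projective

/-! ### The tensor product of M_t(r, η) with a cosyzygy -/

variable {k : Type u} [Field k]

/-- Each cosyzygy step flips the sign, so keeping s as an element of ℤ/2 treats both parities at
once. -/
theorem tensor_M_equiv (h2 : (2 : k) ≠ 0) (s t : ℕ) (r r' : ZMod 2) (η : OnePoint k)
    {N : ModuleCat.{u} (D4 k)} (hN : IsCosyzygy s (V k r') N) :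
    Nonempty (tensorModule (k := k) (M t r η) N ≃ₗ[D4 k]
      ((Fin (s * t) → P k (r + (r' + s))) × M t (r + (r' + s)) η)) := by
  have hP : Nonempty (env k ((Fin t → k) ⊗[k] (Fin s → k)) (r + (r' + s)) ≃ₗ[D4 k]
      (Fin (s * t) → P k (r + (r' + s)))) :=
    env_equiv (by simp [mul_comm]) _
  have hT : ∃ α δ, IsCosyzygy s (V k r') (pencil α δ (r' + s)) ∧
      Nonempty (moduleOf (relations_tensor (relations_pencil (aMap t η) (dMap t η) r)
        (relations_pencil (k := k) (E := Fin s → k) (F := Fin (s + 1) → k) α δ (r' + s)))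
        ≃ₗ[D4 k] env k ((Fin t → k) ⊗[k] (Fin s → k)) (r + (r' + s)) ×
          pencil (aMap t η) (dMap t η) (r + (r' + s))) := by
    have hone : ∀ x : Module.End k (Fin t → k), Commute 1 x := Commute.one_left
    obtain _ | η := η
    · let T : Module.End k (Fin t → k) := shift k t
      refine ⟨consZero k s, snocZero k s, isCosyzygy_consZero_snocZero h2 s r', ?_⟩
      refine tensor_pencil_equiv (by simp) T 1 _ _ (evalAt T s) (evalAt T (s + 1)) (tailMap k s)
        (.inr rfl) (commute_evalAt T s) (fun _ => hone _) (commute_evalAt T _) (fun _ => hone _)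
        (evalAt_consZero T s) (fun e => ?_) (fun z hz => eq_zero_of_map_tailMap T z hz.symm)
        (eq_zero_of_tailMap_of_evalAt T) r _
      rw [evalAt_snocZero, one_mul]
    · let T : Module.End k (Fin t → k) := -shift k t - η • 1
      refine ⟨snocZero k s, consZero k s, isCosyzygy_snocZero_consZero h2 s r', ?_⟩
      refine tensor_pencil_equiv (by simp) 1 T _ _ (evalAt T s) (evalAt T (s + 1)) (tailMap k s)
        (.inl rfl) (fun _ => hone _) (commute_evalAt T s) (fun _ => hone _) (commute_evalAt T _)
        (fun e => ?_) (evalAt_consZero T s) (fun z hz => eq_zero_of_map_tailMap T z hz)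
        (eq_zero_of_tailMap_of_evalAt T) r _
      rw [evalAt_snocZero, one_mul]
  obtain ⟨α, δ, hW, ⟨e₃⟩⟩ := hT
  obtain ⟨e⟩ := hN.nonempty_equiv hW
  obtain ⟨e₁⟩ := tensorModule_congr_right (k := k) (M t r η) e
  -- `M t r η` is by definition the pencil of `aMap t η` and `dMap t η`, so the isomorphisms compose
  -- without a further identification.
  obtain ⟨e₂⟩ := tensorModule_moduleOf (relations_pencil (aMap t η) (dMap t η) r)
    (relations_pencil α δ (r' + s))
  obtain ⟨e₄⟩ := hP
  exact ⟨(e₁.trans (e₂.trans e₃)).trans (e₄.prodCongr (LinearEquiv.refl _ _))⟩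

end D4

theorem corollary2p24 {k : Type u} [Field k] [IsAlgClosed k] (hk : ringChar k ≠ 2)
    (s t : ℕ) (hs : 1 ≤ s) (ht : 1 ≤ t) (r r' : ZMod 2) (η : OnePoint k)
    (N : ModuleCat.{u} (D4 k)) (hN : IsCosyzygy s (D4.V k r') N) :
    (Odd s → Nonempty (tensorModule (k := k) (D4.M t r η) N ≃ₗ[D4 k]
      ((Fin (s * t) → D4.P k (r + r' + 1)) × D4.M t (r + r' + 1) η))) ∧
    (Even s → Nonempty (tensorModule (k := k) (D4.M t r η) N ≃ₗ[D4 k]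
      ((Fin (s * t) → D4.P k (r + r')) × D4.M t (r + r') η))) := by
  have h := D4.tensor_M_equiv (Ring.two_ne_zero hk) s t r r' η hN
  rw [← add_assoc] at h
  refine ⟨fun hodd => ?_, fun heven => ?_⟩
  · rwa [(ZMod.natCast_eq_one_iff_odd).2 hodd] at h
  · rwa [(ZMod.natCast_eq_zero_iff_even).2 heven, add_zero] at h
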